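/- Consider the $(1+2)$-dimensional degenerate Burgers equation $$u_t+uu_x-u_{yy}=0 \qquad(*)$$ for real functions $u=u(t,x,y)$. A point transformation is a $C^\infty$-diffeomorphism $\mathcal T\colon(t,x,y,u)\mapsto(\tilde t,\tilde x,\tilde y,\tilde u)$ from a nonempty connected open subset of $\mathbb R^4$ (the space with coordinates $t,x,y,u$) onto an open subset of $\mathbb R^4$. It is a point symmetry of $(*)$ if it maps solutions to solutions, that is, if whenever $f$ is a $C^\infty$ solution of $(*)$ on an open set $\Omega\subseteq\mathbb R^3$ whose graph lies in the domain of $\mathcal T$, and $\mathcal T$ maps this graph onto the graph of a $C^\infty$ function $g$ on an open set $\tilde\Omega\subseteq\mathbb R^3$, the function $g$ is a solution of $(*)$ on $\tilde\Omega$. Theorem. A homeomorphism from a nonempty connected open subset of $\mathbb R^4$ onto an open subset of $\mathbb R^4$ is a point symmetry of $(*)$ if and only if it is the restriction to its domain of a transformation $$\tilde t=\delta_1^2t+\delta_3,\qquad \tilde x=\delta_2x+\delta_4t+\delta_6,\qquad \tilde y=\delta_1y+\delta_5,\qquad \tilde u=\delta_1^{-2}(\delta_2u+\delta_4),$$ where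 $\delta_1,\dots,\delta_6$ are real constants with $\delta_1\delta_2\neq0$. In particular, the homeomorphisms of $\mathbb R^4$ onto itself that are point symmetries of $(*)$ form a group under composition (the complete point-symmetry group of $(*)$), and this group consists exactly of the above transformations, with $\delta_1,\dots,\delta_6$ arbitrary real constants such that $\delta_1\delta_2\neq0$. -/

import Mathlib

open scoped ContDiff

namespace DegenerateBurgers

/-- The space of independent variables `(t, x, y)`. -/
abbrev Base : Type := ℝ × ℝ × ℝ

/-- The space with coordinates `((t, x, y), u)`. -/
abbrev Total : Type := Base × ℝ

/-- The partial derivative in `t`. -/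
noncomputable def partialT (f : Base → ℝ) (p : Base) : ℝ := fderiv ℝ f p (1, 0, 0)

/-- The partial derivative in `x`. -/
noncomputable def partialX (f : Base → ℝ) (p : Base) : ℝ := fderiv ℝ f p (0, 1, 0)

/-- The partial derivative in `y`. -/
noncomputable def partialY (f : Base → ℝ) (p : Base) : ℝ := fderiv ℝ f p (0, 0, 1)

/-- `f` is a smooth solution of `u_t + u u_x - u_yy = 0` on the set `Ω`
(used for open `Ω` only). -/
def IsSolutionOn (f : Base → ℝ) (Ω : Set Base) : Prop :=
  ContDiffOn ℝ ∞ f Ω ∧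
    ∀ p ∈ Ω, partialT f p + f p * partialX f p - partialY (partialY f) p = 0

/-- A (local) point transformation of the space with coordinates `(t, x, y, u)`: a smooth
diffeomorphism from a connected nonempty open set, `e.source`, onto an open set, `e.target`. -/
def IsPointTransformation (e : OpenPartialHomeomorph Total Total) : Prop :=
  IsConnected e.source ∧ ContDiffOn ℝ ∞ e e.source ∧ ContDiffOn ℝ ∞ e.symm e.target

/-- A point symmetry of `u_t + u u_x - u_yy = 0`: a point transformation that maps solutions to
solutions. Functions are transformed through their graphs: whenever the graph of a solution `f`,
given on an open set and contained in the domain of `e`, is mapped by `e` onto the graph of a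
smooth function `g`, given on an open set, then `g` is again a solution. -/
def IsPointSymmetry (e : OpenPartialHomeomorph Total Total) : Prop :=
  IsPointTransformation e ∧
    ∀ (Ω Ω' : Set Base) (f g : Base → ℝ), IsOpen Ω → IsOpen Ω' →
      IsSolutionOn f Ω → Ω.graphOn f ⊆ e.source →
      ContDiffOn ℝ ∞ g Ω' → e '' Ω.graphOn f = Ω'.graphOn g →
      IsSolutionOn g Ω'

/-- The transformation `t̃ = δ₁² t + δ₃`, `x̃ = δ₂ x + δ₄ t + δ₆`, `ỹ = δ₁ y + δ₅`,
`ũ = δ₁⁻² (δ₂ u + δ₄)`. -/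
noncomputable def transformation (δ₁ δ₂ δ₃ δ₄ δ₅ δ₆ : ℝ) : Total → Total
  | ((t, x, y), u) =>
    ((δ₁ ^ 2 * t + δ₃, δ₂ * x + δ₄ * t + δ₆, δ₁ * y + δ₅), (δ₁ ^ 2)⁻¹ * (δ₂ * u + δ₄))

end DegenerateBurgers

/-! A point symmetry acts on the jets of solutions. If a solution `f` passes through a point with
derivative `l`, and its graph is carried to a surface transversal to the fibres, then the image is
locally the graph of a solution `g`. Differentiating `g ∘ φ` twice along the direction `w` that is
sent to `∂_ỹ`, where `φ` is the induced map of base points, turns the equation for `g` into an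
algebraic relation on the 2-jet of `f` (`IsPointSymmetry.jet_equation`). It is therefore enough to
have explicit solutions with rich jets.

The structural step is `IsPointSymmetry.projectable`: `t̃` and `x̃` depend on `t` and `x` only. Two
solutions with the same 1-jet have images with the same 1-jet, so the equation gives the same
`g_ỹỹ`, and the two second derivatives along `w` must agree. Comparing a rational wave with a family
of solutions affine in `x`, all sharing a 1-jet indexed by `k`, leaves only two possible lines for
`w`. The resulting identities, polynomial in `k`, kill the unwanted derivatives.

The relation then becomes an explicit condition for every 1-jet `(a, b, c)` with `Y_y + c Y_u ≠ 0`
(`JetCondition`). Varying `a`, `b`, `c` yields the determining equations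
(`JetCondition.first_order`, `JetCondition.residual`). Repeated differentiation in `u` splits them
until `Y_y`, `X_x` and `X_t` have zero gradient, hence are constant on the connected domain.

Conversely, each listed map acts on functions by an affine change of variables that rescales the
equation (`IsSolutionOn.transform`), and composing the maps only composes their parameters. -/

namespace DegenerateBurgers

/-! ### Second-order calculus along a fixed direction. -/

section Calculus

variable {E F G : Type*} [NormedAddCommGroup E] [NormedSpace ℝ E] [NormedAddCommGroup F]
  [NormedSpace ℝ F] [NormedAddCommGroup G] [NormedSpace ℝ G]

/-- The second derivative of `f` at `p` along the vector `w`, taken twice. -/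
noncomputable def secondDeriv (f : E → F) (p w : E) : F :=
  fderiv ℝ (fun q => fderiv ℝ f q w) p w

theorem _root_.ContDiffAt.fderiv_apply_const {f : E → F} {p : E} (hf : ContDiffAt ℝ ∞ f p) (v : E) :
    ContDiffAt ℝ ∞ (fun q => fderiv ℝ f q v) p :=
  (hf.fderiv_right (m := ∞) (by simp)).clm_apply contDiffAt_const

theorem two_le_infty : (2 : WithTop ℕ∞) ≤ ∞ := 
  WithTop.coe_le_coe.2 (le_top : (2 : ℕ∞) ≤ ⊤)

theorem eventually_contDiffAt_two {f : E → F} {p : E} (hf : ContDiffAt ℝ ∞ f p) :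
    ∀ᶠ q in nhds p, ContDiffAt ℝ 2 f q :=
  (hf.of_le two_le_infty).eventually (by simp)

theorem eventually_differentiableAt {f : E → F} {p : E} (hf : ContDiffAt ℝ ∞ f p) :
    ∀ᶠ q in nhds p, DifferentiableAt ℝ f q :=
  (eventually_contDiffAt_two hf).mono fun _ h => h.differentiableAt (by norm_num)

theorem secondDeriv_comp {g : F → G} {f : E → F} {p : E} (hg : ContDiffAt ℝ ∞ g (f p))
    (hf : ContDiffAt ℝ ∞ f p) (w : E) :
    secondDeriv (g ∘ f) p w =
      secondDeriv g (f p) (fderiv ℝ f p w) + fderiv ℝ g (f p) (secondDeriv f p w) := by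
  have h1 : (fun q => fderiv ℝ (g ∘ f) q w) =ᶠ[nhds p]
      fun q => fderiv ℝ g (f q) (fderiv ℝ f q w) := by
    filter_upwards [eventually_differentiableAt hf,
      hf.continuousAt.eventually (eventually_differentiableAt hg)] with q h h'
    rw [fderiv_comp q h' h]
    rfl
  have hdf : DifferentiableAt ℝ (fun q => fderiv ℝ f q w) p :=
    (hf.fderiv_apply_const w).differentiableAt (by simp)
  have hdg : DifferentiableAt ℝ (fderiv ℝ g) (f p) :=
    (hg.fderiv_right (m := ∞) (by simp)).differentiableAt (by simp)
  have hf1 : DifferentiableAt ℝ f p := hf.differentiableAt (by simp)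
  have h2 : HasFDerivAt (fun q => fderiv ℝ g (f q)) _ p :=
    hdg.hasFDerivAt.comp p hf1.hasFDerivAt
  have h3 := h2.clm_apply hdf.hasFDerivAt
  have h4 : secondDeriv g (f p) (fderiv ℝ f p w) =
      fderiv ℝ (fderiv ℝ g) (f p) (fderiv ℝ f p w) (fderiv ℝ f p w) := by
    have := hdg.hasFDerivAt.clm_apply (hasFDerivAt_const (fderiv ℝ f p w) (f p))
    rw [secondDeriv, this.fderiv]
    simp
  rw [h4, secondDeriv, h1.fderiv_eq, h3.fderiv]
  simp [secondDeriv, add_comm]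

theorem secondDeriv_congr {f g : E → F} {p : E} (h : f =ᶠ[nhds p] g) (w : E) :
    secondDeriv f p w = secondDeriv g p w := by
  have : (fun q => fderiv ℝ f q w) =ᶠ[nhds p] fun q => fderiv ℝ g q w := by
    filter_upwards [h.fderiv (𝕜 := ℝ)] with q hq
    rw [hq]
  rw [secondDeriv, this.fderiv_eq]
  rfl

theorem secondDeriv_clm_comp (T : F →L[ℝ] G) {f : E → F} {p : E} (hf : ContDiffAt ℝ ∞ f p)
    (w : E) : secondDeriv (fun q => T (f q)) p w = T (secondDeriv f p w) := by
  have := secondDeriv_comp (g := T) T.contDiff.contDiffAt hf w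
  simpa [secondDeriv, Function.comp_def] using this

theorem fderiv_clm_comp (T : F →L[ℝ] G) {f : E → F} {p : E} (hf : DifferentiableAt ℝ f p)
    (w : E) : fderiv ℝ (fun q => T (f q)) p w = T (fderiv ℝ f p w) := by
  have := T.hasFDerivAt.comp p hf.hasFDerivAt
  exact congrArg (fun A : E →L[ℝ] G => A w) (HasFDerivAt.fderiv this)

theorem fderiv_graph {f : E → F} {p : E} (hf : DifferentiableAt ℝ f p) (w : E) :
    fderiv ℝ (fun q => (q, f q)) p w = (w, fderiv ℝ f p w) := by
  have := (hasFDerivAt_id p).prodMk hf.hasFDerivAt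
  rw [show (fun q => (q, f q)) = fun q => (id q, f q) from rfl, this.fderiv]
  rfl

theorem secondDeriv_graph {f : E → F} {p : E} (hf : ContDiffAt ℝ ∞ f p) (w : E) :
    secondDeriv (fun q => (q, f q)) p w = (0, secondDeriv f p w) := by
  have h : (fun q => fderiv ℝ (fun q => (q, f q)) q w) =ᶠ[nhds p] fun q => (w, fderiv ℝ f q w) := by
    filter_upwards [eventually_differentiableAt hf] with q hq
    exact fderiv_graph hq w
  have h2 := (hasFDerivAt_const w p).prodMk
    ((hf.fderiv_apply_const w).differentiableAt (by simp)).hasFDerivAt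
  rw [secondDeriv, h.fderiv_eq, h2.fderiv]
  rfl

theorem fderiv_fderiv_comm {f : E → F} {p : E} (hf : ContDiffAt ℝ ∞ f p) (v w : E) :
    fderiv ℝ (fun q => fderiv ℝ f q v) p w = fderiv ℝ (fun q => fderiv ℝ f q w) p v := by
  have hd : DifferentiableAt ℝ (fderiv ℝ f) p :=
    (hf.fderiv_right (m := ∞) (by simp)).differentiableAt (by simp)
  have key (v w : E) : fderiv ℝ (fun q => fderiv ℝ f q v) p w =
      fderiv ℝ (fderiv ℝ f) p w v := by
    rw [(hd.hasFDerivAt.clm_apply (hasFDerivAt_const v p)).fderiv]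
    simp
  rw [key, key]
  exact (hf.isSymmSndFDerivAt (by simpa using two_le_infty)).eq w v

end Calculus

/-! ### The action of point transformations on graphs and jets. -/

theorem IsPointTransformation.contDiffAt {e : OpenPartialHomeomorph Total Total}
    (he : IsPointTransformation e) {p : Total} (hp : p ∈ e.source) : ContDiffAt ℝ ∞ e p :=
  he.2.1.contDiffAt (e.open_source.mem_nhds hp)

/-- Near a point where the graph of `f` is transformed into a surface transversal to the fibres,
the transformed surface is the graph of a smooth function. -/
theorem exists_transformed_function {e : OpenPartialHomeomorph Total Total}
    (he : IsPointTransformation e) {Ω : Set Base} {f : Base → ℝ} (hΩ : IsOpen Ω)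
    (hf : ContDiffOn ℝ ∞ f Ω) {q : Base} (hq : q ∈ Ω) (hS : (q, f q) ∈ e.source)
    (hinj : ∀ v, (fderiv ℝ e (q, f q) (v, fderiv ℝ f q v)).1 = 0 → v = 0) :
    ∃ (Ω₁ Ω' : Set Base) (g : Base → ℝ), IsOpen Ω₁ ∧ IsOpen Ω' ∧ Ω₁ ⊆ Ω ∧ q ∈ Ω₁ ∧
      Ω₁.graphOn f ⊆ e.source ∧ ContDiffOn ℝ ∞ g Ω' ∧ e '' Ω₁.graphOn f = Ω'.graphOn g := by
  have hfat : ∀ r ∈ Ω, ContDiffAt ℝ ∞ f r := fun r hr => hf.contDiffAt (hΩ.mem_nhds hr)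
  have hF : ContinuousOn (fun r => (r, f r)) Ω := continuousOn_id.prodMk hf.continuousOn
  set Ω₂ : Set Base := Ω ∩ (fun r => (r, f r)) ⁻¹' e.source
  have hΩ₂o : IsOpen Ω₂ := hF.isOpen_inter_preimage hΩ e.open_source
  set φ : Base → Base := fun r => (e (r, f r)).1 with hφ
  have hEs : ∀ r ∈ Ω₂, ContDiffAt ℝ ∞ (fun r => e (r, f r)) r := fun r hr =>
    (he.contDiffAt hr.2).comp r (contDiffAt_id.prodMk (hfat r hr.1))
  have hφs : ∀ r ∈ Ω₂, ContDiffAt ℝ ∞ φ r := fun r hr => (hEs r hr).fst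
  have hq2 : q ∈ Ω₂ := ⟨hq, hS⟩
  have hder : ∀ v, fderiv ℝ φ q v = (fderiv ℝ e (q, f q) (v, fderiv ℝ f q v)).1 := by
    intro v
    have hfd : DifferentiableAt ℝ f q := (hfat q hq).differentiableAt (by simp)
    have h0 : DifferentiableAt ℝ e (q, f q) := (he.contDiffAt hS).differentiableAt (by simp)
    have h1 := fderiv_clm_comp (ContinuousLinearMap.fst ℝ Base ℝ)
      ((hEs q hq2).differentiableAt (by simp)) v
    have h2 := fderiv_comp q (g := e) (f := fun r => (r, f r)) h0
      (differentiableAt_id.prodMk hfd)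
    have h3 : fderiv ℝ (fun r => e (r, f r)) q v = fderiv ℝ e (q, f q) (v, fderiv ℝ f q v) := by
      rw [← fderiv_graph hfd, show (fun r => e (r, f r)) = e ∘ fun r => (r, f r) from rfl, h2]
      rfl
    rw [h3] at h1
    exact h1
  have hker : (fderiv ℝ φ q : Base →ₗ[ℝ] Base).ker = ⊥ := by
    rw [LinearMap.ker_eq_bot']
    intro v hv
    exact hinj v ((hder v).symm.trans hv)
  let A₀ : Base ≃L[ℝ] Base :=
    (LinearEquiv.ofInjectiveEndo (fderiv ℝ φ q : Base →ₗ[ℝ] Base)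
      (LinearMap.ker_eq_bot.1 hker)).toContinuousLinearEquiv
  have hA₀ : (A₀ : Base →L[ℝ] Base) = fderiv ℝ φ q := by
    ext <;> rfl
  have hφd : HasFDerivAt φ (A₀ : Base →L[ℝ] Base) q := by
    rw [hA₀]; exact ((hφs q hq2).differentiableAt (by simp)).hasFDerivAt
  let H := (hφs q hq2).toOpenPartialHomeomorph φ hφd (by simp)
  have hH : (H : Base → Base) = φ := rfl
  set W : Set (Base →L[ℝ] Base) := Set.range ((↑) : (Base ≃L[ℝ] Base) → Base →L[ℝ] Base)
  have hW : IsOpen W := ContinuousLinearEquiv.isOpen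
  have hcont : ContinuousOn (fderiv ℝ φ) Ω₂ := fun r hr =>
    (((hφs r hr).fderiv_right (m := ∞) (by simp)).continuousAt).continuousWithinAt
  -- The local inverse `H.symm` is known to be smooth only at images of points where the derivative
  -- of `φ` is invertible, so the neighbourhood is shrunk to the open set of such points.
  set Ω₃ : Set Base := Ω₂ ∩ fderiv ℝ φ ⁻¹' W
  have hΩ₃ : IsOpen Ω₃ := hcont.isOpen_inter_preimage hΩ₂o hW
  refine ⟨H.source ∩ Ω₃, H.target ∩ H.symm ⁻¹' Ω₃, fun P => (e (H.symm P, f (H.symm P))).2,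
    H.open_source.inter hΩ₃, H.isOpen_inter_preimage_symm hΩ₃, ?_, ?_, ?_, ?_, ?_⟩
  · exact fun r hr => hr.2.1.1
  · exact ⟨(hφs q hq2).mem_toOpenPartialHomeomorph_source hφd (by simp), hq2, A₀, hA₀⟩
  · rintro _ ⟨r, hr, rfl⟩
    exact hr.2.1.2
  · rintro P ⟨hP, hP2, B, hB⟩
    have hs : ContDiffAt ℝ ∞ H.symm P := by
      refine H.contDiffAt_symm (f₀' := B) hP ?_ (hφs _ hP2)
      rw [hB]
      exact ((hφs _ hP2).differentiableAt (by simp)).hasFDerivAt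
    exact (((hEs _ hP2).comp P hs).snd).contDiffWithinAt
  · ext Z
    constructor
    · rintro ⟨_, ⟨r, hr, rfl⟩, rfl⟩
      refine ⟨φ r, ⟨H.map_source hr.1, ?_⟩, ?_⟩
      · change H.symm (H r) ∈ Ω₃
        rw [H.left_inv hr.1]; exact hr.2
      · change (H r, (e (H.symm (H r), f (H.symm (H r)))).2) = _
        rw [H.left_inv hr.1]
        rfl
    · rintro ⟨P, hP, rfl⟩
      refine ⟨_, ⟨H.symm P, ⟨H.map_target hP.1, hP.2⟩, rfl⟩, ?_⟩
      have : (e (H.symm P, f (H.symm P))).1 = P := H.right_inv hP.1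
      exact Prod.ext this rfl

/-- The condition on the 2-jets of solutions imposed by a point symmetry. -/
theorem IsPointSymmetry.jet_equation {e : OpenPartialHomeomorph Total Total}
    (he : IsPointSymmetry e) {Ω : Set Base} {f : Base → ℝ} (hΩ : IsOpen Ω)
    (hf : IsSolutionOn f Ω) {q : Base} (hq : q ∈ Ω) (hS : (q, f q) ∈ e.source)
    (hinj : ∀ v, (fderiv ℝ e (q, f q) (v, fderiv ℝ f q v)).1 = 0 → v = 0) :
    ∃ m : Base →L[ℝ] ℝ,
      (∀ v, m (fderiv ℝ e (q, f q) (v, fderiv ℝ f q v)).1 =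
        (fderiv ℝ e (q, f q) (v, fderiv ℝ f q v)).2) ∧
      ∀ w, (fderiv ℝ e (q, f q) (w, fderiv ℝ f q w)).1 = (0, 0, 1) →
        m (1, 0, 0) + (e (q, f q)).2 * m (0, 1, 0) =
          (secondDeriv e (q, f q) (w, fderiv ℝ f q w) +
            fderiv ℝ e (q, f q) (0, secondDeriv f q w)).2 -
          m (secondDeriv e (q, f q) (w, fderiv ℝ f q w) +
            fderiv ℝ e (q, f q) (0, secondDeriv f q w)).1 := by
  obtain ⟨Ω₁, Ω', g, ho, ho', hsub, hq1, hgr, hg, him⟩ :=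
    exists_transformed_function he.1 hΩ hf.1 hq hS hinj
  have hsol := he.2 Ω₁ Ω' f g ho ho'
    ⟨hf.1.mono hsub, fun p hp => hf.2 p (hsub hp)⟩ hgr hg him
  have hpt : ∀ r ∈ Ω₁, (e (r, f r)).1 ∈ Ω' ∧ g (e (r, f r)).1 = (e (r, f r)).2 := by
    intro r hr
    have : e (r, f r) ∈ Ω'.graphOn g := by
      rw [← him]; exact ⟨_, ⟨r, hr, rfl⟩, rfl⟩
    obtain ⟨P, hP, h⟩ := this
    have h1 : P = (e (r, f r)).1 := congrArg Prod.fst h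
    have h2 : g P = (e (r, f r)).2 := congrArg Prod.snd h
    subst h1
    exact ⟨hP, h2⟩
  have hfs : ContDiffAt ℝ ∞ f q := hf.1.contDiffAt (hΩ.mem_nhds hq)
  have hfd : DifferentiableAt ℝ f q := hfs.differentiableAt (by simp)
  have hes : ContDiffAt ℝ ∞ e (q, f q) := he.1.contDiffAt hS
  have hFs : ContDiffAt ℝ ∞ (fun r => (r, f r)) q := contDiffAt_id.prodMk hfs
  have hEs : ContDiffAt ℝ ∞ (fun r => e (r, f r)) q := hes.comp q hFs
  have hgs : ContDiffAt ℝ ∞ g (e (q, f q)).1 := hg.contDiffAt (ho'.mem_nhds (hpt q hq1).1)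
  have hEd (v : Base) : fderiv ℝ (fun r => e (r, f r)) q v =
      fderiv ℝ e (q, f q) (v, fderiv ℝ f q v) := by
    have := fderiv_comp q (g := e) (f := fun r => (r, f r)) (hes.differentiableAt (by simp))
      (hFs.differentiableAt (by simp))
    rw [← fderiv_graph hfd, show (fun r => e (r, f r)) = e ∘ fun r => (r, f r) from rfl, this]
    rfl
  have hE2 (w : Base) : secondDeriv (fun r => e (r, f r)) q w =
      secondDeriv e (q, f q) (w, fderiv ℝ f q w) +
            fderiv ℝ e (q, f q) (0, secondDeriv f q w) := by
    rw [← fderiv_graph hfd, ← secondDeriv_graph hfs]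
    exact secondDeriv_comp (f := fun r => (r, f r)) hes hFs w
  have hev : (fun r => g (e (r, f r)).1) =ᶠ[nhds q] fun r => (e (r, f r)).2 := by
    filter_upwards [ho.mem_nhds hq1] with r hr
    exact (hpt r hr).2
  have h1d (v : Base) : fderiv ℝ (fun r => (e (r, f r)).1) q v =
      (fderiv ℝ e (q, f q) (v, fderiv ℝ f q v)).1 := by
    rw [← hEd]
    exact fderiv_clm_comp (ContinuousLinearMap.fst ℝ Base ℝ) (hEs.differentiableAt (by simp)) v
  -- The covector is the derivative of the transformed solution; both claims come from
  -- differentiating the identity `hev` once and twice.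
  refine ⟨fderiv ℝ g (e (q, f q)).1, fun v => ?_, fun w hw => ?_⟩
  · have h1 := fderiv_comp q (g := g) (f := fun r => (e (r, f r)).1)
      (hgs.differentiableAt (by simp)) (hEs.fst.differentiableAt (by simp))
    have h2 := fderiv_clm_comp (ContinuousLinearMap.snd ℝ Base ℝ)
      (hEs.differentiableAt (by simp)) v
    rw [← h1d]
    have h3 := congrArg (fun A : Base →L[ℝ] ℝ => A v) (hev.fderiv_eq)
    rw [hEd] at h2
    exact (congrArg (fun A : Base →L[ℝ] ℝ => A v) h1).symm.trans (h3.trans h2)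
  · have h1 := secondDeriv_comp (g := g) (f := fun r => (e (r, f r)).1) hgs hEs.fst w
    have h2 := secondDeriv_congr hev w
    have h3 := secondDeriv_clm_comp (ContinuousLinearMap.fst ℝ Base ℝ) hEs w
    have h4 := secondDeriv_clm_comp (ContinuousLinearMap.snd ℝ Base ℝ) hEs w
    simp only [ContinuousLinearMap.coe_fst', ContinuousLinearMap.coe_snd', hE2] at h3 h4
    -- Because `w` is sent to `∂_ỹ`, the first term of the second-order chain rule is `g_ỹỹ`, which
    -- the equation for `g` replaces by first-order data.
    rw [h1d, hw] at h1
    have h5 := hsol.2 _ (hpt q hq1).1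
    rw [(hpt q hq1).2] at h5
    have h6 : partialY (partialY g) (e (q, f q)).1 = secondDeriv g (e (q, f q)).1 (0, 0, 1) := rfl
    rw [← h3, ← h4, ← h2]
    have h7 : secondDeriv (fun r => g (e (r, f r)).1) q w = _ := h1
    rw [h7]
    rw [h6] at h5
    change partialT g _ + _ * partialX g _ = _
    linarith

/-- The invertibility of the derivative of a point transformation. -/
theorem IsPointTransformation.exists_equiv {e : OpenPartialHomeomorph Total Total}
    (he : IsPointTransformation e) {p : Total} (hp : p ∈ e.source) :
    ∃ L : Total ≃L[ℝ] Total, fderiv ℝ e p = L := by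
  have h1 : HasFDerivAt e (fderiv ℝ e p) p :=
    ((he.contDiffAt hp).differentiableAt (by simp)).hasFDerivAt
  have ht : e p ∈ e.target := e.map_source hp
  have h2 : HasFDerivAt e.symm (fderiv ℝ e.symm (e p)) (e p) :=
    ((he.2.2.contDiffAt (e.open_target.mem_nhds ht)).differentiableAt (by simp)).hasFDerivAt
  have h3 : (fderiv ℝ e.symm (e p)).comp (fderiv ℝ e p) = ContinuousLinearMap.id ℝ Total := by
    refine (h2.comp p h1).unique ((hasFDerivAt_id p).congr_of_eventuallyEq ?_)
    filter_upwards [e.open_source.mem_nhds hp] with r hr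
    exact e.left_inv hr
  have h4 : (fderiv ℝ e p).comp (fderiv ℝ e.symm (e p)) = ContinuousLinearMap.id ℝ Total := by
    have h1' : HasFDerivAt e (fderiv ℝ e p) (e.symm (e p)) := by rwa [e.left_inv hp]
    refine (h1'.comp (e p) h2).unique ((hasFDerivAt_id (e p)).congr_of_eventuallyEq ?_)
    filter_upwards [e.open_target.mem_nhds ht] with r hr
    exact e.right_inv hr
  exact ⟨ContinuousLinearEquiv.equivOfInverse _ _
    (fun v => congrArg (fun A : Total →L[ℝ] Total => A v) h3)
    (fun v => congrArg (fun A : Total →L[ℝ] Total => A v) h4), by ext <;> rfl⟩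

/-! ### Two explicit families of solutions. -/

theorem fderiv_fun_div_apply {E : Type*} [NormedAddCommGroup E] [NormedSpace ℝ E] {N D : E → ℝ}
    {p : E} (hN : DifferentiableAt ℝ N p) (hD : DifferentiableAt ℝ D p) (h : D p ≠ 0) (v : E) :
    fderiv ℝ (fun q => N q / D q) p v =
      (fderiv ℝ N p v - N p / D p * fderiv ℝ D p v) / D p := by
  have h1 := hN.hasFDerivAt.mul ((hasDerivAt_inv h).comp_hasFDerivAt p hD.hasFDerivAt)
  have h2 : (fun q => N q / D q) = N * ((fun x : ℝ => x⁻¹) ∘ D) := by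
    ext; simp [div_eq_mul_inv]
  rw [h2, HasFDerivAt.fderiv h1]
  simp
  field_simp
  ring

/-- Solutions of the form `(b x + C(t, y)) / (1 + b t)`, centred at `q`, where `C` is a heat
polynomial. -/
noncomputable def linearSolution (q : Base) (u b c h d : ℝ) (p : Base) : ℝ :=
  (b * (p.2.1 - q.2.1) + (u + c * (p.2.2 - q.2.2) + h * ((p.1 - q.1) + (p.2.2 - q.2.2) ^ 2 / 2) +
    d * ((p.2.2 - q.2.2) ^ 4 / 24 + (p.1 - q.1) * (p.2.2 - q.2.2) ^ 2 / 2 + (p.1 - q.1) ^ 2 / 2))) /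
    (1 + b * (p.1 - q.1))

/-- The domain of `linearSolution`. -/
def linearDomain (q : Base) (b : ℝ) : Set Base := {p | 1 + b * (p.1 - q.1) ≠ 0}

theorem isOpen_linearDomain (q : Base) (b : ℝ) : IsOpen (linearDomain q b) :=
  isOpen_ne_fun (by fun_prop) continuous_const

theorem mem_linearDomain (q : Base) (b : ℝ) : q ∈ linearDomain q b := by
  simp [linearDomain]

theorem linearSolution_self (q : Base) (u b c h d : ℝ) : linearSolution q u b c h d q = u := by
  simp [linearSolution]

theorem contDiffOn_linearSolution (q : Base) (u b c h d : ℝ) :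
    ContDiffOn ℝ ∞ (linearSolution q u b c h d) (linearDomain q b) :=
  ContDiffOn.div (by fun_prop) (by fun_prop) fun _ hp => hp

theorem fderiv_linearSolution (q : Base) (u b c h d : ℝ) {p : Base}
    (hp : p ∈ linearDomain q b) (v : Base) :
    fderiv ℝ (linearSolution q u b c h d) p v =
      (b * v.2.1 + (h + d * ((p.2.2 - q.2.2) ^ 2 / 2 + (p.1 - q.1))) * v.1 +
        (c + h * (p.2.2 - q.2.2) + d * ((p.2.2 - q.2.2) ^ 3 / 6 + (p.1 - q.1) * (p.2.2 - q.2.2))) *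
          v.2.2 - linearSolution q u b c h d p * (b * v.1)) / (1 + b * (p.1 - q.1)) := by
  have h1 := fderiv_fun_div_apply (N := fun p : Base => b * (p.2.1 - q.2.1) +
    (u + c * (p.2.2 - q.2.2) + h * ((p.1 - q.1) + (p.2.2 - q.2.2) ^ 2 / 2) +
    d * ((p.2.2 - q.2.2) ^ 4 / 24 + (p.1 - q.1) * (p.2.2 - q.2.2) ^ 2 / 2 + (p.1 - q.1) ^ 2 / 2)))
    (D := fun p : Base => 1 + b * (p.1 - q.1)) (p := p) (by fun_prop) (by fun_prop) hp v
  refine h1.trans ?_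
  unfold linearSolution
  congr 2
  · simp (disch := fun_prop) [fderiv_fun_add, fderiv_fun_sub, fderiv_fun_mul, fderiv_fun_pow,
      fderiv.fst, fderiv.snd, div_eq_mul_inv]
    ring
  · congr 1
    simp (disch := fun_prop) [fderiv_fun_sub, fderiv_fun_mul, fderiv.fst]

theorem secondDeriv_linearSolution (q : Base) (u b c h d : ℝ) {p : Base}
    (hp : p ∈ linearDomain q b) (w : Base) :
    secondDeriv (linearSolution q u b c h d) p w =
      (d * ((p.2.2 - q.2.2) * w.2.2 + w.1) * w.1 +
        (h * w.2.2 + d * ((p.2.2 - q.2.2) ^ 2 / 2 * w.2.2 + (p.2.2 - q.2.2) * w.1 +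
          (p.1 - q.1) * w.2.2)) * w.2.2 -
        2 * fderiv ℝ (linearSolution q u b c h d) p w * (b * w.1)) / (1 + b * (p.1 - q.1)) := by
  have hev : (fun r => fderiv ℝ (linearSolution q u b c h d) r w) =ᶠ[nhds p] _ :=
    Filter.mem_of_superset ((isOpen_linearDomain q b).mem_nhds hp)
      fun r hr => fderiv_linearSolution q u b c h d hr w
  have hd : DifferentiableAt ℝ (linearSolution q u b c h d) p :=
    ((contDiffOn_linearSolution q u b c h d).contDiffAt
      ((isOpen_linearDomain q b).mem_nhds hp)).differentiableAt (by simp)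
  rw [secondDeriv, hev.fderiv_eq, fderiv_fun_div_apply
    (D := fun p : Base => 1 + b * (p.1 - q.1)) (by fun_prop) (by fun_prop) hp,
    ← fderiv_linearSolution q u b c h d hp w]
  congr 1
  simp (disch := fun_prop) [fderiv_fun_add, fderiv_fun_sub, fderiv_fun_mul, fderiv_fun_pow,
      fderiv.fst, fderiv.snd, div_eq_mul_inv]
  ring

/-- For `f = (b x + C) / (1 + b t)` the contributions of `b` to `f_t + f f_x` cancel and leave `C_t
/ (1 + b t)`, so the equation reduces to the heat equation `C_t = C_yy`. The term with `d` is
invisible in the 1-jet at `q` and contributes there only to the second derivative in `t`. -/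
theorem isSolutionOn_linearSolution (q : Base) (u b c h d : ℝ) :
    IsSolutionOn (linearSolution q u b c h d) (linearDomain q b) := by
  refine ⟨contDiffOn_linearSolution q u b c h d, fun p hp => ?_⟩
  have h1 : partialY (partialY (linearSolution q u b c h d)) p =
    secondDeriv (linearSolution q u b c h d) p (0, 0, 1) := rfl
  rw [h1, secondDeriv_linearSolution _ _ _ _ _ _ hp, partialT, partialX,
    fderiv_linearSolution _ _ _ _ _ _ hp, fderiv_linearSolution _ _ _ _ _ _ hp]
  have hp' : 1 + b * (p.1 - q.1) ≠ 0 := hp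
  field_simp
  simp
  ring

/-- Rational travelling-wave solutions, centred at `q`. -/
noncomputable def rationalSolution (q : Base) (u k : ℝ) (p : Base) : ℝ :=
  u - k ^ 2 + k ^ 2 / (1 - k * (p.2.2 - q.2.2) - 2 * (p.2.1 - q.2.1) -
    2 * (k ^ 2 - u) * (p.1 - q.1))

/-- The domain of `rationalSolution`. -/
def rationalDomain (q : Base) (u k : ℝ) : Set Base :=
  {p | 1 - k * (p.2.2 - q.2.2) - 2 * (p.2.1 - q.2.1) - 2 * (k ^ 2 - u) * (p.1 - q.1) ≠ 0}

theorem isOpen_rationalDomain (q : Base) (u k : ℝ) : IsOpen (rationalDomain q u k) :=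
  isOpen_ne_fun (by fun_prop) continuous_const

theorem mem_rationalDomain (q : Base) (u k : ℝ) : q ∈ rationalDomain q u k := by
  simp [rationalDomain]

theorem rationalSolution_self (q : Base) (u k : ℝ) : rationalSolution q u k q = u := by
  simp [rationalSolution]

theorem contDiffOn_rationalSolution (q : Base) (u k : ℝ) :
    ContDiffOn ℝ ∞ (rationalSolution q u k) (rationalDomain q u k) :=
  contDiffOn_const.add (ContDiffOn.div (by fun_prop) (by fun_prop) fun _ hp => hp)

theorem fderiv_rationalSolution (q : Base) (u k : ℝ) {p : Base} (hp : p ∈ rationalDomain q u k)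
    (v : Base) :
    fderiv ℝ (rationalSolution q u k) p v =
      k ^ 2 * (k * v.2.2 + 2 * v.2.1 + 2 * (k ^ 2 - u) * v.1) /
        (1 - k * (p.2.2 - q.2.2) - 2 * (p.2.1 - q.2.1) - 2 * (k ^ 2 - u) * (p.1 - q.1)) ^ 2 := by
  have hp' : 1 - k * (p.2.2 - q.2.2) - 2 * (p.2.1 - q.2.1) - 2 * (k ^ 2 - u) * (p.1 - q.1) ≠ 0 := hp
  have h1 := fderiv_fun_div_apply (N := fun _ : Base => k ^ 2)
    (D := fun p : Base => 1 - k * (p.2.2 - q.2.2) - 2 * (p.2.1 - q.2.1) -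
      2 * (k ^ 2 - u) * (p.1 - q.1)) (p := p) (by fun_prop) (by fun_prop) hp v
  have h2 : fderiv ℝ (rationalSolution q u k) p = _ := fderiv_const_add (u - k ^ 2)
  rw [h2, h1]
  simp (disch := fun_prop) [fderiv_fun_sub, fderiv_fun_mul, fderiv.fst, fderiv.snd]
  field_simp
  ring

theorem secondDeriv_rationalSolution (q : Base) (u k : ℝ) {p : Base}
    (hp : p ∈ rationalDomain q u k) (w : Base) :
    secondDeriv (rationalSolution q u k) p w =
      2 * k ^ 2 * (k * w.2.2 + 2 * w.2.1 + 2 * (k ^ 2 - u) * w.1) ^ 2 /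
        (1 - k * (p.2.2 - q.2.2) - 2 * (p.2.1 - q.2.1) - 2 * (k ^ 2 - u) * (p.1 - q.1)) ^ 3 := by
  have hp' : 1 - k * (p.2.2 - q.2.2) - 2 * (p.2.1 - q.2.1) - 2 * (k ^ 2 - u) * (p.1 - q.1) ≠ 0 := hp
  have hev : (fun r => fderiv ℝ (rationalSolution q u k) r w) =ᶠ[nhds p] _ :=
    Filter.mem_of_superset ((isOpen_rationalDomain q u k).mem_nhds hp)
      fun r hr => fderiv_rationalSolution q u k hr w
  rw [secondDeriv, hev.fderiv_eq, fderiv_fun_div_apply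
    (D := fun p : Base => (1 - k * (p.2.2 - q.2.2) - 2 * (p.2.1 - q.2.1) -
      2 * (k ^ 2 - u) * (p.1 - q.1)) ^ 2) (by fun_prop) (by fun_prop) (pow_ne_zero 2 hp)]
  simp (disch := fun_prop) [fderiv_fun_sub, fderiv_fun_mul, fderiv_fun_pow,
    fderiv.fst, fderiv.snd]
  field_simp
  ring

/-- With `D` the denominator, the coefficient of `t` in `D` is chosen to cancel the constant `u - k
^ 2` in front of `f_x`; both `f_t + f f_x` and `f_yy` then equal `2 k ^ 4 / D ^ 3`. -/
theorem isSolutionOn_rationalSolution (q : Base) (u k : ℝ) :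
    IsSolutionOn (rationalSolution q u k) (rationalDomain q u k) := by
  refine ⟨contDiffOn_rationalSolution q u k, fun p hp => ?_⟩
  have hp' : 1 - k * (p.2.2 - q.2.2) - 2 * (p.2.1 - q.2.1) - 2 * (k ^ 2 - u) * (p.1 - q.1) ≠ 0 := hp
  have h1 : partialY (partialY (rationalSolution q u k)) p =
    secondDeriv (rationalSolution q u k) p (0, 0, 1) := rfl
  rw [h1, secondDeriv_rationalSolution _ _ _ hp, partialT, partialX,
    fderiv_rationalSolution _ _ _ hp, fderiv_rationalSolution _ _ _ hp, rationalSolution]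
  dsimp only
  field_simp
  ring

/-! ### Projectability: `t̃` and `x̃` are functions of `t` and `x`. -/

theorem surjective_of_injective_graph {L : Total →L[ℝ] Total} {l : Base →L[ℝ] ℝ}
    (hinj : ∀ v, (L (v, l v)).1 = 0 → v = 0) (P : Base) : ∃ v, (L (v, l v)).1 = P := by
  let A : Base →ₗ[ℝ] Base :=
    ((ContinuousLinearMap.fst ℝ Base ℝ).comp
      (L.comp ((ContinuousLinearMap.id ℝ Base).prod l)) : Base →L[ℝ] Base)
  have h1 : Function.Injective A := LinearMap.ker_eq_bot.1 (LinearMap.ker_eq_bot'.2 hinj)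
  exact LinearMap.injective_iff_surjective.1 h1 P

/-- Transversality of a graph to the preimage of the fibre direction. -/
theorem injective_graph_of_ne {L : Total ≃L[ℝ] Total} {l : Base →L[ℝ] ℝ}
    (h : l (L.symm (0, 1)).1 ≠ (L.symm (0, 1)).2) (v : Base) (hv : (L (v, l v)).1 = 0) : v = 0 := by
  have h1 : L (v, l v) = (L (v, l v)).2 • ((0, 1) : Total) := by
    refine Prod.ext ?_ ?_ <;> simp [hv]
  have h2 : (v, l v) = (L (v, l v)).2 • L.symm (0, 1) := by
    rw [← map_smul, ← h1, L.symm_apply_apply]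
  generalize (L (v, l v)).2 = s at h2
  have h3 : v = s • (L.symm (0, 1)).1 := congrArg Prod.fst h2
  have h4 : l v = s * (L.symm (0, 1)).2 := congrArg Prod.snd h2
  have h5 : s = 0 := by
    rw [h3, map_smul, smul_eq_mul] at h4
    by_contra hs
    exact h (mul_left_cancel₀ hs h4)
  rw [h3, h5, zero_smul]

/-- Two solutions with the same 1-jet have the same second derivative in the direction that a
point symmetry maps to the direction of `y`. -/
theorem IsPointSymmetry.secondDeriv_eq {e : OpenPartialHomeomorph Total Total}
    (he : IsPointSymmetry e) {Ω₁ Ω₂ : Set Base} {f₁ f₂ : Base → ℝ} (hΩ₁ : IsOpen Ω₁)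
    (hΩ₂ : IsOpen Ω₂) (hf₁ : IsSolutionOn f₁ Ω₁) (hf₂ : IsSolutionOn f₂ Ω₂) {q : Base} {u : ℝ}
    {l : Base →L[ℝ] ℝ} (hq₁ : q ∈ Ω₁) (hq₂ : q ∈ Ω₂) (hu₁ : f₁ q = u) (hu₂ : f₂ q = u)
    (hl₁ : fderiv ℝ f₁ q = l) (hl₂ : fderiv ℝ f₂ q = l) (hS : (q, u) ∈ e.source)
    (hinj : ∀ v, (fderiv ℝ e (q, u) (v, l v)).1 = 0 → v = 0) {w : Base}
    (hw : (fderiv ℝ e (q, u) (w, l w)).1 = (0, 0, 1)) :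
    secondDeriv f₁ q w = secondDeriv f₂ q w := by
  obtain ⟨m₁, hm₁, h₁⟩ := he.jet_equation hΩ₁ hf₁ hq₁ (by rwa [hu₁]) (by rwa [hu₁, hl₁])
  obtain ⟨m₂, hm₂, h₂⟩ := he.jet_equation hΩ₂ hf₂ hq₂ (by rwa [hu₂]) (by rwa [hu₂, hl₂])
  rw [hu₁, hl₁] at hm₁ h₁
  rw [hu₂, hl₂] at hm₂ h₂
  obtain ⟨L, hL⟩ := he.1.exists_equiv hS
  -- The image tangent plane projects onto the whole base, so the common 1-jet determines the
  -- covector.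
  have hm : m₁ = m₂ := by
    refine ContinuousLinearMap.ext fun P => ?_
    obtain ⟨v, hv⟩ := surjective_of_injective_graph hinj P
    rw [← hv, hm₁, hm₂]
  subst hm
  have h1 := h₁ w hw
  have h2 := h₂ w hw
  simp only [Prod.snd_add, Prod.fst_add, map_add] at h1 h2
  set δ := secondDeriv f₁ q w - secondDeriv f₂ q w with hδ
  have e1 : ((0 : Base), δ) = (0, secondDeriv f₁ q w) - (0, secondDeriv f₂ q w) := by
    simp [hδ]
  -- The image of the vertical vector `(0, δ)` lies in the image tangent plane. By injectivity `(0,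
  -- δ)` is then tangent to the original graph, which forces `δ = 0`.
  have h3 : (fderiv ℝ e (q, u) (0, δ)).2 = m₁ (fderiv ℝ e (q, u) (0, δ)).1 := by
    rw [e1, map_sub, Prod.snd_sub, Prod.fst_sub, map_sub]
    linarith
  obtain ⟨v, hv⟩ := surjective_of_injective_graph hinj (fderiv ℝ e (q, u) (0, δ)).1
  have h4 : fderiv ℝ e (q, u) (v, l v) = fderiv ℝ e (q, u) (0, δ) := by
    refine Prod.ext hv ?_
    rw [h3, ← hm₁, hv]
  rw [hL] at h4
  have h5 := L.injective h4
  have h6 : v = 0 := congrArg Prod.fst h5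
  have h7 : l v = δ := congrArg Prod.snd h5
  rw [h6, map_zero] at h7
  linarith

open Polynomial in
-- Multiplying by `k` and by the quartic absorbs the excluded values of `k`. The product vanishes at
-- every real number, so it is the zero polynomial, and one of the two cubic factors is zero; either
-- way its coefficients of degree 0 and 3 give the claim.
theorem eq_zero_of_generic {α β γ δ p q r : ℝ} (h0 : ¬ (α = 0 ∧ β = 0 ∧ γ = 0 ∧ δ = 0))
    (h : ∀ k : ℝ, k ≠ 0 → α * k ^ 4 + β * k ^ 3 + γ * k ^ 2 + δ ≠ 0 →
      (q + k ^ 3 * r) * (q - k * p - k ^ 3 * r) = 0) : q = 0 ∧ r = 0 := by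
  set P : ℝ[X] := C α * X ^ 4 + C β * X ^ 3 + C γ * X ^ 2 + C δ with hP
  set Q : ℝ[X] := C q + X ^ 3 * C r with hQ
  set R : ℝ[X] := C q - X * C p - X ^ 3 * C r with hR
  have hz : X * P * (Q * R) = 0 := by
    refine Polynomial.funext fun k => ?_
    simp only [hP, hQ, hR, eval_mul, eval_add, eval_sub, eval_C, eval_X, eval_pow, eval_zero]
    by_cases hk : k = 0
    · simp [hk]
    by_cases hk' : α * k ^ 4 + β * k ^ 3 + γ * k ^ 2 + δ = 0
    · rw [hk']; ring
    · rw [h k hk hk', mul_zero]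
  have hP0 : P ≠ 0 := by
    intro hP0
    have hc (i : ℕ) : P.coeff i = 0 := by rw [hP0, coeff_zero]
    have c0 := hc 0
    have c2 := hc 2
    have c3 := hc 3
    have c4 := hc 4
    simp [hP, coeff_C, coeff_X_pow] at c0 c2 c3 c4
    exact h0 ⟨c4, c3, c2, c0⟩
  rcases mul_eq_zero.1 hz with h1 | h1
  · exact absurd h1 (mul_ne_zero X_ne_zero hP0)
  rcases mul_eq_zero.1 h1 with h1 | h1
  · have c0 := congrArg (fun p => coeff p 0) h1
    have c3 := congrArg (fun p => coeff p 3) h1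
    simp [hQ, coeff_C, coeff_X_pow] at c0 c3
    exact ⟨c0, c3⟩
  · have c0 := congrArg (fun p => coeff p 0) h1
    have c3 := congrArg (fun p => coeff p 3) h1
    simp [hR, coeff_C, coeff_X_pow, coeff_X] at c0 c3
    exact ⟨c0, c3⟩

theorem total_decomp (v : Total) :
    v = v.1.1 • ((1, 0, 0), 0) + v.1.2.1 • ((0, 1, 0), 0) + v.1.2.2 • ((0, 0, 1), 0) +
      v.2 • ((0, 0, 0), 1) := by
  refine Prod.ext (Prod.ext ?_ (Prod.ext ?_ ?_)) ?_ <;> simp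

theorem clm_total_apply (A : Total →L[ℝ] ℝ) (v : Total) :
    A v = v.1.1 * A ((1, 0, 0), 0) + v.1.2.1 * A ((0, 1, 0), 0) + v.1.2.2 * A ((0, 0, 1), 0) +
      v.2 * A ((0, 0, 0), 1) := by
  conv_lhs => rw [total_decomp v]
  simp only [map_add, map_smul, smul_eq_mul]

/-- The new variables `t` and `x` do not depend on `y` and `u`. -/
theorem IsPointSymmetry.projectable {e : OpenPartialHomeomorph Total Total}
    (he : IsPointSymmetry e) {p : Total} (hp : p ∈ e.source) (Z : Base →L[ℝ] ℝ)
    (hZ : Z (0, 0, 1) = 0) :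
    Z (fderiv ℝ e p ((0, 0, 1), 0)).1 = 0 ∧ Z (fderiv ℝ e p ((0, 0, 0), 1)).1 = 0 := by
  obtain ⟨q, u⟩ := p
  obtain ⟨L, hL⟩ := he.1.exists_equiv hp
  set n := L.symm (0, 1) with hn
  let A : Total →L[ℝ] ℝ := (Z.comp (ContinuousLinearMap.fst ℝ Base ℝ)).comp (fderiv ℝ e (q, u))
  have hA (v : Total) : A v = Z (fderiv ℝ e (q, u) v).1 := rfl
  rw [← hA, ← hA]
  -- The quartic is `l n.1 - n.2`, where `l` is the 1-jet used below and `n` is the direction sent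
  -- to the fibre; its nonvanishing is transversality of the image graph.
  refine eq_zero_of_generic (α := 2 * n.1.1) (β := n.1.2.2) (γ := 2 * n.1.2.1 - 2 * u * n.1.1)
    (δ := - n.2) (p := A ((0, 1, 0), 0)) ?_ ?_
  · rintro ⟨h1, h2, h3, h4⟩
    have h5 : n = 0 := by
      have h1' : n.1.1 = 0 := by linarith
      rw [h1'] at h3
      refine Prod.ext (Prod.ext h1' (Prod.ext ?_ h2)) ?_ <;> simp <;> linarith
    have : L n = 0 := by rw [h5, map_zero]
    rw [hn, L.apply_symm_apply] at this
    simpa using congrArg Prod.snd this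
  intro k hk hne
  set l := fderiv ℝ (rationalSolution q u k) q with hl
  have hlv (v : Base) : l v = k ^ 2 * (k * v.2.2 + 2 * v.2.1 + 2 * (k ^ 2 - u) * v.1) := by
    rw [hl, fderiv_rationalSolution q u k (mem_rationalDomain q u k)]
    simp
  -- The parameters are those for which the derivative at `q` matches the rational wave, with `d`
  -- left free.
  have hlin (d : ℝ) :
      fderiv ℝ (linearSolution q u (2 * k ^ 2) (k ^ 3) (2 * k ^ 4) d) q = l := by
    refine ContinuousLinearMap.ext fun v => ?_
    rw [hlv, fderiv_linearSolution _ _ _ _ _ _ (mem_linearDomain q _), linearSolution_self]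
    simp
    ring
  have hinj : ∀ v, (fderiv ℝ e (q, u) (v, l v)).1 = 0 → v = 0 := by
    rw [hL]
    refine injective_graph_of_ne ?_
    rw [hlv]
    intro h
    apply hne
    rw [← hn] at h
    linear_combination h
  obtain ⟨w, hw⟩ := surjective_of_injective_graph hinj (0, 0, 1)
  have key (d : ℝ) := he.secondDeriv_eq (isOpen_rationalDomain q u k) (isOpen_linearDomain q _)
    (isSolutionOn_rationalSolution q u k)
    (isSolutionOn_linearSolution q u (2 * k ^ 2) (k ^ 3) (2 * k ^ 4) d)
    (mem_rationalDomain q u k) (mem_linearDomain q _) (rationalSolution_self q u k)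
    (linearSolution_self _ _ _ _ _ _) hl.symm (hlin d) hp hinj hw
  simp only [secondDeriv_rationalSolution q u k (mem_rationalDomain q u k),
    secondDeriv_linearSolution _ _ _ _ _ _ (mem_linearDomain q _), hlin, sub_self] at key
  have k0 := key 0
  have k1 := key 1
  simp at k0 k1
  -- The two values of `d` differ only through `d * w.1 ^ 2`.
  have ht : w.1 = 0 := by
    rw [k0] at k1
    have : w.1 * w.1 = 0 := by linarith
    simpa using this
  rw [ht] at k0
  -- With `w.1 = 0` the equality of second derivatives reads `2 k² (k w_y + 2 w_x)² = 2 k⁴ w_y²`.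
  have hx : w.2.1 * (w.2.1 + k * w.2.2) = 0 := by
    have : k ^ 2 * (w.2.1 * (w.2.1 + k * w.2.2)) = 0 := by linear_combination k0 / 8
    exact (mul_eq_zero.1 this).resolve_left (pow_ne_zero 2 hk)
  have hA0 : A (w, l w) = 0 := by rw [hA, hw, hZ]
  rw [clm_total_apply, hlv] at hA0
  simp only [ht] at hA0
  have hwne : w.2.2 ≠ 0 := by
    intro hy
    rw [hy] at hx
    have hx' : w.2.1 = 0 := by simpa using hx
    have : w = 0 := Prod.ext ht (Prod.ext hx' hy)
    have h0 : ((0 : Base), (0 : ℝ)) = 0 := rfl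
    rw [this, map_zero, h0, map_zero] at hw
    simpa using congrArg (fun P : Base => P.2.2) hw
  have h2 : w.2.2 * (A ((0, 0, 1), 0) + k ^ 3 * A ((0, 0, 0), 1)) = 0 ∨
    w.2.2 * (A ((0, 0, 1), 0) - k * A ((0, 1, 0), 0) - k ^ 3 * A ((0, 0, 0), 1)) = 0 := by
    rcases mul_eq_zero.1 hx with hx | hx
    · left
      rw [hx] at hA0
      linear_combination hA0
    · right
      have : w.2.1 = - k * w.2.2 := by linear_combination hx
      rw [this] at hA0
      linear_combination hA0
  rcases h2 with h2 | h2
  · rw [(mul_eq_zero.1 h2).resolve_left hwne, zero_mul]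
  · rw [(mul_eq_zero.1 h2).resolve_left hwne, mul_zero]

/-! ### The jet condition in components. -/

/-- The partial derivative in `t` of a function of `(t, x, y, u)`. -/
noncomputable def dT (F : Total → ℝ) (p : Total) : ℝ := fderiv ℝ F p ((1, 0, 0), 0)

/-- The partial derivative in `x` of a function of `(t, x, y, u)`. -/
noncomputable def dX (F : Total → ℝ) (p : Total) : ℝ := fderiv ℝ F p ((0, 1, 0), 0)

/-- The partial derivative in `y` of a function of `(t, x, y, u)`. -/
noncomputable def dY (F : Total → ℝ) (p : Total) : ℝ := fderiv ℝ F p ((0, 0, 1), 0)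

/-- The partial derivative in `u` of a function of `(t, x, y, u)`. -/
noncomputable def dU (F : Total → ℝ) (p : Total) : ℝ := fderiv ℝ F p ((0, 0, 0), 1)

theorem fderiv_total_apply (F : Total → ℝ) (p v : Total) :
    fderiv ℝ F p v = v.1.1 * dT F p + v.1.2.1 * dX F p + v.1.2.2 * dY F p + v.2 * dU F p :=
  clm_total_apply _ _

theorem clm_base_apply (m : Base →L[ℝ] ℝ) (v : Base) :
    m v = v.1 * m (1, 0, 0) + v.2.1 * m (0, 1, 0) + v.2.2 * m (0, 0, 1) := by
  have : v = v.1 • (1, 0, 0) + v.2.1 • (0, 1, 0) + v.2.2 • (0, 0, 1) := by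
    refine Prod.ext ?_ (Prod.ext ?_ ?_) <;> simp
  conv_lhs => rw [this]
  simp only [map_add, map_smul, smul_eq_mul]

theorem secondDeriv_vertical {F : Total → ℝ} {p : Total} (hF : ContDiffAt ℝ ∞ F p) (s c : ℝ) :
    secondDeriv F p ((0, 0, s), c * s) = s ^ 2 * (dY (dY F) p + c * (dU (dY F) p + dY (dU F) p) +
      c ^ 2 * dU (dU F) p) := by
  have h1 : (fun q => fderiv ℝ F q ((0, 0, s), c * s)) = fun q => s * dY F q + c * s * dU F q := by
    funext q
    rw [fderiv_total_apply]
    simp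
  have hy : DifferentiableAt ℝ (dY F) p := (hF.fderiv_apply_const _).differentiableAt (by simp)
  have hu : DifferentiableAt ℝ (dU F) p := (hF.fderiv_apply_const _).differentiableAt (by simp)
  have h2 := (hy.hasFDerivAt.const_mul s).add (hu.hasFDerivAt.const_mul (c * s))
  rw [secondDeriv, h1]
  refine (congrArg (fun A : Total →L[ℝ] ℝ => A ((0, 0, s), c * s)) (HasFDerivAt.fderiv h2)).trans ?_
  simp only [add_apply, smul_apply, fderiv_total_apply, smul_eq_mul]
  ring

/-- The nondegeneracy of a point transformation for which `t̃` and `x̃` depend on `t` and `x`. -/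
theorem det_ne_zero_of_surjective {Tt Tx Xt Xx Yt Yx Yy Yu Ut Ux Uy Uu : ℝ}
    (h : ∀ r₁ r₂ r₃ r₄ : ℝ, ∃ t x y u : ℝ, t * Tt + x * Tx = r₁ ∧ t * Xt + x * Xx = r₂ ∧
      t * Yt + x * Yx + y * Yy + u * Yu = r₃ ∧ t * Ut + x * Ux + y * Uy + u * Uu = r₄) :
    Tt * Xx - Tx * Xt ≠ 0 ∧ Yy * Uu - Yu * Uy ≠ 0 := by
  have hΔ : Tt * Xx - Tx * Xt ≠ 0 := by
    obtain ⟨t, x, -, -, h1, h2, -, -⟩ := h 1 0 0 0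
    obtain ⟨t', x', -, -, h1', h2', -, -⟩ := h 0 1 0 0
    intro h0
    -- Multiplicativity of the 2 × 2 determinant.
    have : (Tt * Xx - Tx * Xt) * (t * x' - x * t') = 1 := by
      calc _ = (t * Tt + x * Tx) * (t' * Xt + x' * Xx) - (t' * Tt + x' * Tx) * (t * Xt + x * Xx) := by
            ring
        _ = 1 := by rw [h1, h2, h1', h2']; norm_num
    rw [h0, zero_mul] at this
    norm_num at this
  refine ⟨hΔ, ?_⟩
  have hz {t x : ℝ} (h1 : t * Tt + x * Tx = 0) (h2 : t * Xt + x * Xx = 0) : t = 0 ∧ x = 0 := by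
    constructor
    · refine (mul_eq_zero.1 (?_ : (Tt * Xx - Tx * Xt) * t = 0)).resolve_left hΔ
      linear_combination Xx * h1 - Tx * h2
    · refine (mul_eq_zero.1 (?_ : (Tt * Xx - Tx * Xt) * x = 0)).resolve_left hΔ
      linear_combination Tt * h2 - Xt * h1
  obtain ⟨t, x, y, u, h1, h2, h3, h4⟩ := h 0 0 1 0
  obtain ⟨t', x', y', u', h1', h2', h3', h4'⟩ := h 0 0 0 1
  obtain ⟨rfl, rfl⟩ := hz h1 h2
  obtain ⟨rfl, rfl⟩ := hz h1' h2'
  simp only [zero_mul, zero_add] at h3 h4 h3' h4'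
  intro h0
  have : (Yy * Uu - Yu * Uy) * (y * u' - u * y') = 1 := by
    calc _ = (y * Yy + u * Yu) * (y' * Uy + u' * Uu) - (y' * Yy + u' * Yu) * (y * Uy + u * Uu) := by
          ring
      _ = 1 := by rw [h3, h4, h3', h4']; norm_num
  rw [h0, zero_mul] at this
  norm_num at this

/-- The condition that a point symmetry with components `T`, `X`, `Y`, `U`, where `T` and `X` depend
on `t` and `x` only, imposes on the jets of solutions at `p`. -/
def JetCondition (T X Y U : Total → ℝ) (p : Total) : Prop :=
  ∀ a b c : ℝ, dY Y p + c * dU Y p ≠ 0 → ∃ mT mX mY : ℝ,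
    mT * dT T p + mX * dT X p + mY * (dT Y p + a * dU Y p) = dT U p + a * dU U p ∧
    mT * dX T p + mX * dX X p + mY * (dX Y p + b * dU Y p) = dX U p + b * dU U p ∧
    mY * (dY Y p + c * dU Y p) = dY U p + c * dU U p ∧
    (dY Y p + c * dU Y p) ^ 2 * (mT + U p * mX) =
      (dY (dY U) p + c * (dU (dY U) p + dY (dU U) p) + c ^ 2 * dU (dU U) p +
        (a + p.2 * b) * dU U p) -
      mY * (dY (dY Y) p + c * (dU (dY Y) p + dY (dU Y) p) + c ^ 2 * dU (dU Y) p +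
        (a + p.2 * b) * dU Y p)

section Components

variable {e : OpenPartialHomeomorph Total Total}

theorem IsPointTransformation.fderiv_eq (he : IsPointTransformation e) {p : Total}
    (hp : p ∈ e.source) (v : Total) :
    fderiv ℝ e p v = ((fderiv ℝ (fun q => (e q).1.1) p v, fderiv ℝ (fun q => (e q).1.2.1) p v,
      fderiv ℝ (fun q => (e q).1.2.2) p v), fderiv ℝ (fun q => (e q).2) p v) := by
  have h := (he.contDiffAt hp).differentiableAt (by simp)
  refine Prod.ext (Prod.ext ?_ (Prod.ext ?_ ?_)) ?_
  · exact (fderiv_clm_comp ((ContinuousLinearMap.fst ℝ ℝ (ℝ × ℝ)).comp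
      (ContinuousLinearMap.fst ℝ Base ℝ)) h v).symm
  · exact (fderiv_clm_comp (((ContinuousLinearMap.fst ℝ ℝ ℝ).comp
      (ContinuousLinearMap.snd ℝ ℝ (ℝ × ℝ))).comp (ContinuousLinearMap.fst ℝ Base ℝ)) h v).symm
  · exact (fderiv_clm_comp (((ContinuousLinearMap.snd ℝ ℝ ℝ).comp
      (ContinuousLinearMap.snd ℝ ℝ (ℝ × ℝ))).comp (ContinuousLinearMap.fst ℝ Base ℝ)) h v).symm
  · exact (fderiv_clm_comp (ContinuousLinearMap.snd ℝ Base ℝ) h v).symm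

theorem IsPointTransformation.secondDeriv_eq (he : IsPointTransformation e) {p : Total}
    (hp : p ∈ e.source) (v : Total) :
    secondDeriv e p v = ((secondDeriv (fun q => (e q).1.1) p v,
      secondDeriv (fun q => (e q).1.2.1) p v, secondDeriv (fun q => (e q).1.2.2) p v),
      secondDeriv (fun q => (e q).2) p v) := by
  have h := he.contDiffAt hp
  refine Prod.ext (Prod.ext ?_ (Prod.ext ?_ ?_)) ?_
  · exact (secondDeriv_clm_comp ((ContinuousLinearMap.fst ℝ ℝ (ℝ × ℝ)).comp
      (ContinuousLinearMap.fst ℝ Base ℝ)) h v).symm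
  · exact (secondDeriv_clm_comp (((ContinuousLinearMap.fst ℝ ℝ ℝ).comp
      (ContinuousLinearMap.snd ℝ ℝ (ℝ × ℝ))).comp (ContinuousLinearMap.fst ℝ Base ℝ)) h v).symm
  · exact (secondDeriv_clm_comp (((ContinuousLinearMap.snd ℝ ℝ ℝ).comp
      (ContinuousLinearMap.snd ℝ ℝ (ℝ × ℝ))).comp (ContinuousLinearMap.fst ℝ Base ℝ)) h v).symm
  · exact (secondDeriv_clm_comp (ContinuousLinearMap.snd ℝ Base ℝ) h v).symm

theorem IsPointSymmetry.vertical_eq_zero (he : IsPointSymmetry e) {p : Total} (hp : p ∈ e.source) :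
    dY (fun q => (e q).1.1) p = 0 ∧ dU (fun q => (e q).1.1) p = 0 ∧
      dY (fun q => (e q).1.2.1) p = 0 ∧ dU (fun q => (e q).1.2.1) p = 0 := by
  have h1 := he.projectable hp (ContinuousLinearMap.fst ℝ ℝ (ℝ × ℝ)) rfl
  have h2 := he.projectable hp ((ContinuousLinearMap.fst ℝ ℝ ℝ).comp
    (ContinuousLinearMap.snd ℝ ℝ (ℝ × ℝ))) rfl
  simp only [he.1.fderiv_eq hp] at h1 h2
  exact ⟨h1.1, h1.2, h2.1, h2.2⟩

theorem IsPointSymmetry.det_ne_zero (he : IsPointSymmetry e) {p : Total} (hp : p ∈ e.source) :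
    dT (fun q => (e q).1.1) p * dX (fun q => (e q).1.2.1) p -
      dX (fun q => (e q).1.1) p * dT (fun q => (e q).1.2.1) p ≠ 0 ∧
    dY (fun q => (e q).1.2.2) p * dU (fun q => (e q).2) p -
      dU (fun q => (e q).1.2.2) p * dY (fun q => (e q).2) p ≠ 0 := by
  obtain ⟨L, hL⟩ := he.1.exists_equiv hp
  obtain ⟨h1, h2, h3, h4⟩ := he.vertical_eq_zero hp
  refine det_ne_zero_of_surjective (Yt := dT (fun q => (e q).1.2.2) p)
    (Yx := dX (fun q => (e q).1.2.2) p) (Ut := dT (fun q => (e q).2) p)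
    (Ux := dX (fun q => (e q).2) p) fun r₁ r₂ r₃ r₄ => ?_
  obtain ⟨⟨⟨t, x, y⟩, u⟩, hv⟩ := L.surjective ((r₁, r₂, r₃), r₄)
  have hv' : fderiv ℝ e p ((t, x, y), u) = ((r₁, r₂, r₃), r₄) := by rw [hL]; exact hv
  rw [he.1.fderiv_eq hp] at hv'
  simp only [fderiv_total_apply, h1, h2, h3, h4, mul_zero, add_zero, Prod.mk.injEq] at hv'
  exact ⟨t, x, y, u, hv'.1.1, hv'.1.2.1, hv'.1.2.2, hv'.2⟩

/-- An affine-in-`x` solution realises any first derivatives `(a, b, c)`, with `f_yy = a + u b`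
forced by the equation. By projectability the direction sent to `∂_ỹ` is `∂_y / κ` with `κ = Y_y + c
Y_u`; the last equation is `jet_equation` multiplied by `κ ^ 2`. -/
theorem IsPointSymmetry.jetCondition (he : IsPointSymmetry e) {p : Total} (hp : p ∈ e.source) :
    JetCondition (fun q => (e q).1.1) (fun q => (e q).1.2.1) (fun q => (e q).1.2.2)
      (fun q => (e q).2) p := by
  intro a b c hκ
  obtain ⟨q, u⟩ := p
  have hc := he.1.contDiffAt hp
  have hmem : ∀ᶠ r in nhds ((q, u) : Total), r ∈ e.source := e.open_source.mem_nhds hp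
  obtain ⟨h1, h2, h3, h4⟩ := he.vertical_eq_zero hp
  obtain ⟨hΔ, -⟩ := he.det_ne_zero hp
  -- The denominator contributes `-b u` to the derivative in `t`, so `h = a + b * u` makes that
  -- derivative equal to `a`.
  set f := linearSolution q u b c (a + b * u) 0 with hf
  have hfq : f q = u := linearSolution_self _ _ _ _ _ _
  have hl (v : Base) : fderiv ℝ f q v = a * v.1 + b * v.2.1 + c * v.2.2 := by
    rw [fderiv_linearSolution _ _ _ _ _ _ (mem_linearDomain q b), ← hf, hfq]
    simp
    ring
  have hinj : ∀ v, (fderiv ℝ e (q, f q) (v, fderiv ℝ f q v)).1 = 0 → v = 0 := by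
    rw [hfq]
    rintro ⟨t, x, y⟩ hv
    rw [he.1.fderiv_eq hp, hl] at hv
    simp only [fderiv_total_apply, h1, h2, h3, h4, mul_zero, add_zero, Prod.mk_eq_zero] at hv
    obtain ⟨e1, e2, e3⟩ := hv
    have ht : t = 0 := by
      refine (mul_eq_zero.1 ?_).resolve_left hΔ
      linear_combination dX (fun q => (e q).1.2.1) (q, u) * e1 -
        dX (fun q => (e q).1.1) (q, u) * e2
    have hx : x = 0 := by
      refine (mul_eq_zero.1 ?_).resolve_left hΔ
      linear_combination dT (fun q => (e q).1.1) (q, u) * e2 -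
        dT (fun q => (e q).1.2.1) (q, u) * e1
    subst ht hx
    have hy : y = 0 := by
      refine (mul_eq_zero.1 ?_).resolve_left hκ
      linear_combination e3
    rw [hy]
    rfl
  obtain ⟨m, hm, hm2⟩ := he.jet_equation (isOpen_linearDomain q b)
    (isSolutionOn_linearSolution q u b c (a + b * u) 0) (mem_linearDomain q b)
    (by rw [← hf, hfq]; exact hp) (by rw [← hf]; exact hinj)
  rw [← hf, hfq] at hm hm2
  set κ := dY (fun q => (e q).1.2.2) (q, u) + c * dU (fun q => (e q).1.2.2) (q, u) with hκd
  have hm2 := hm2 (0, 0, κ⁻¹)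
  have hs2 : secondDeriv f q (0, 0, κ⁻¹) = (a + b * u) * (κ⁻¹) ^ 2 := by
    rw [hf, secondDeriv_linearSolution _ _ _ _ _ _ (mem_linearDomain q b)]
    simp
    ring_nf
  have hzero {F : Total → ℝ} (hF : ContDiffAt ℝ ∞ F (q, u))
      (h : ∀ r ∈ e.source, dY F r = 0 ∧ dU F r = 0) :
      secondDeriv F (q, u) ((0, 0, κ⁻¹), c * κ⁻¹) = 0 := by
    have hev : (fun r => fderiv ℝ F r ((0, 0, κ⁻¹), c * κ⁻¹)) =ᶠ[nhds (q, u)] fun _ => 0 := by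
      filter_upwards [hmem] with r hr
      rw [fderiv_total_apply, (h r hr).1, (h r hr).2]
      simp
    rw [secondDeriv, hev.fderiv_eq]
    simp
  have hm_t := hm (1, 0, 0)
  have hm_x := hm (0, 1, 0)
  have hm_y := hm (0, 0, 1)
  simp only [he.1.fderiv_eq hp, he.1.secondDeriv_eq hp, hl, hs2] at hm_t hm_x hm_y hm2
  simp only [mul_zero, add_zero, zero_add, mul_one] at hm_t hm_x hm_y hm2
  rw [hzero hc.fst.fst fun r hr => ⟨(he.vertical_eq_zero hr).1, (he.vertical_eq_zero hr).2.1⟩,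
    hzero hc.fst.snd.fst fun r hr => (he.vertical_eq_zero hr).2.2,
    secondDeriv_vertical hc.fst.snd.snd, secondDeriv_vertical hc.snd] at hm2
  simp only [fderiv_total_apply] at hm_t hm_x hm_y hm2
  rw [clm_base_apply] at hm_t hm_x hm_y
  simp only [h1, h2, h3, h4, mul_zero, add_zero, zero_add, zero_mul, one_mul, Prod.mk_add_mk,
    Prod.fst_zero, Prod.snd_zero] at hm_t hm_x hm_y hm2
  have hm3 := hm2 (by
    rw [show κ⁻¹ * dY (fun q => (e q).1.2.2) (q, u) + c * κ⁻¹ * dU (fun q => (e q).1.2.2) (q, u) =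
      κ⁻¹ * κ by rw [hκd]; ring, inv_mul_cancel₀ hκ])
  have hexp (r : ℝ) : m (0, 0, r) = r * m (0, 0, 1) := by
    rw [clm_base_apply]
    simp
  rw [hexp] at hm3
  refine ⟨m (1, 0, 0), m (0, 1, 0), m (0, 0, 1), ?_, ?_, ?_, ?_⟩
  · linear_combination hm_t
  · linear_combination hm_x
  · linear_combination hm_y
  · rw [hm3]
    field_simp

end Components

/-! ### Determining equations obtained by varying the jet. -/

section JetConsequences

variable {T X Y U : Total → ℝ} {p : Total}

/-- The third equation fixes `mY` independently of `a` and `b`. Subtracting the condition at `a = b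
= 0` from those with `a = 1` or `b = 1` removes all second-order terms of the transformation, and
eliminating `mT`, `mX` leaves relations in which `c` enters only through `Y_y + c Y_u`. -/
theorem JetCondition.first_order (h : JetCondition T X Y U p)
    (hΔ : dT T p * dX X p - dX T p * dT X p ≠ 0) (hj : dY Y p * dU U p - dU Y p * dY U p ≠ 0) :
    dU Y p = 0 ∧
      (dX X p - U p * dX T p) * dY Y p ^ 2 = dT T p * dX X p - dX T p * dT X p ∧
      (U p * dT T p - dT X p) * dY Y p ^ 2 = p.2 * (dT T p * dX X p - dX T p * dT X p) := by
  have key (c : ℝ) (hκ : dY Y p + c * dU Y p ≠ 0) :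
      (dX X p - U p * dX T p) * (dY Y p + c * dU Y p) ^ 2 =
        dT T p * dX X p - dX T p * dT X p ∧
      (U p * dT T p - dT X p) * (dY Y p + c * dU Y p) ^ 2 =
        p.2 * (dT T p * dX X p - dX T p * dT X p) := by
    obtain ⟨r, s, m, a1, a2, a3, a4⟩ := h 0 0 c hκ
    obtain ⟨r', s', m', b1, b2, b3, b4⟩ := h 1 0 c hκ
    obtain ⟨r'', s'', m'', c1, c2, c3, c4⟩ := h 0 1 c hκ
    obtain rfl : m' = m := mul_right_cancel₀ hκ (b3.trans a3.symm)
    obtain rfl : m'' = m' := mul_right_cancel₀ hκ (c3.trans b3.symm)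
    -- Multiplied by `Y_y + c Y_u`, this factor becomes the Jacobian in `hj`.
    have hl : dU U p - m'' * dU Y p ≠ 0 := by
      intro h0
      apply hj
      linear_combination (dY Y p + c * dU Y p) * h0 + dU Y p * c3
    constructor
    · refine mul_right_cancel₀ hl ?_
      linear_combination
        (dY Y p + c * dU Y p) ^ 2 * (- (dX X p - U p * dX T p) * (b1 - a1) +
          (dT X p - U p * dT T p) * (b2 - a2)) +
        (dT T p * dX X p - dX T p * dT X p) * (b4 - a4)
    · refine mul_right_cancel₀ hl ?_
      linear_combination
        (dY Y p + c * dU Y p) ^ 2 * (- (dX X p - U p * dX T p) * (c1 - a1) +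
          (dT X p - U p * dT T p) * (c2 - a2)) +
        (dT T p * dX X p - dX T p * dT X p) * (c4 - a4)
  have hY : dU Y p = 0 := by
    by_contra hne
    -- If `Y_u ≠ 0`, then `Y_y + c Y_u` can be given the values 1 and 2, and the relation would
    -- equate a quantity and its quadruple with the determinant in `hΔ`.
    have e1 : dY Y p + (1 - dY Y p) / dU Y p * dU Y p = 1 := by field_simp; ring
    have e2 : dY Y p + (2 - dY Y p) / dU Y p * dU Y p = 2 := by field_simp; ring
    have h1 := (key _ (by rw [e1]; norm_num)).1
    have h2 := (key _ (by rw [e2]; norm_num)).1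
    rw [e1] at h1
    rw [e2] at h2
    apply hΔ
    linarith
  have hYy : dY Y p + 0 * dU Y p ≠ 0 := by
    intro h0
    apply hj
    have : dY Y p = 0 := by linarith
    rw [this, hY]; ring
  refine ⟨hY, ?_⟩
  simpa using key 0 hYy

/-- Once the second-order terms vanish, the condition at `a = b = 0` says `mT + U mX = 0`. Together
with `hU` this gives `U_t + u U_x = mY (Y_t + u Y_x)`, where `mY = c U_u / Y_y` varies with `c`
while the left side does not. -/
theorem JetCondition.residual (h : JetCondition T X Y U p) (hTx : dX T p = 0) (hYu : dU Y p = 0)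
    (hYy : dY Y p ≠ 0) (hUy : dY U p = 0) (hUu : dU U p ≠ 0)
    (hU : U p * dT T p = p.2 * dX X p + dT X p)
    (h1 : dY (dY U) p = 0) (h2 : dU (dY U) p = 0) (h3 : dY (dU U) p = 0) (h4 : dU (dU U) p = 0)
    (h5 : dY (dY Y) p = 0) (h6 : dU (dY Y) p = 0) (h7 : dY (dU Y) p = 0) (h8 : dU (dU Y) p = 0) :
    dT U p + p.2 * dX U p = 0 ∧ dT Y p + p.2 * dX Y p = 0 := by
  have key (c : ℝ) : ∃ m, m * dY Y p = c * dU U p ∧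
      dT U p + p.2 * dX U p = m * (dT Y p + p.2 * dX Y p) := by
    obtain ⟨r, s, m, a1, a2, a3, a4⟩ := h 0 0 c (by rw [hYu]; simpa using hYy)
    rw [h1, h2, h3, h4, h5, h6, h7, h8, hYu] at a4
    rw [hYu] at a1 a2 a3
    rw [hTx] at a2
    rw [hUy] at a3
    have a5 : dY Y p ^ 2 * (r + U p * s) = 0 := by linear_combination a4
    have a6 := (mul_eq_zero.1 a5).resolve_left (pow_ne_zero 2 hYy)
    refine ⟨m, by linear_combination a3, ?_⟩
    linear_combination - a1 - p.2 * a2 + dT T p * a6 - s * hU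
  obtain ⟨m, h0, h0'⟩ := key 0
  obtain ⟨n, h1, h1'⟩ := key 1
  have hm : m = 0 := by simpa [hYy] using h0
  have hn : n ≠ 0 := by
    rintro rfl
    apply hUu
    linarith
  rw [hm, zero_mul] at h0'
  rw [h0'] at h1'
  exact ⟨h0', (mul_eq_zero.1 h1'.symm).resolve_left hn⟩

end JetConsequences

/-! ### Integration of the determining equations. -/

section Differentiation

variable {F G : Total → ℝ} {S : Set Total} {p : Total}

theorem fderiv_eq_dT (F : Total → ℝ) (p : Total) : fderiv ℝ F p ((1, 0, 0), 0) = dT F p := rfl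

theorem fderiv_eq_dX (F : Total → ℝ) (p : Total) : fderiv ℝ F p ((0, 1, 0), 0) = dX F p := rfl

theorem fderiv_eq_dY (F : Total → ℝ) (p : Total) : fderiv ℝ F p ((0, 0, 1), 0) = dY F p := rfl

theorem fderiv_eq_dU (F : Total → ℝ) (p : Total) : fderiv ℝ F p ((0, 0, 0), 1) = dU F p := rfl

theorem fderiv_apply_eq_of_eqOn (hS : IsOpen S) (h : ∀ q ∈ S, F q = G q) (hp : p ∈ S) (v : Total) :
    fderiv ℝ F p v = fderiv ℝ G p v := by
  have : F =ᶠ[nhds p] G := Filter.mem_of_superset (hS.mem_nhds hp) h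
  rw [this.fderiv_eq]

theorem fderiv_fun_mul_apply (hF : DifferentiableAt ℝ F p) (hG : DifferentiableAt ℝ G p)
    (v : Total) :
    fderiv ℝ (fun q => F q * G q) p v = fderiv ℝ F p v * G p + F p * fderiv ℝ G p v := by
  rw [fderiv_fun_mul hF hG]
  simp
  ring

theorem fderiv_fun_add_apply (hF : DifferentiableAt ℝ F p) (hG : DifferentiableAt ℝ G p)
    (v : Total) :
    fderiv ℝ (fun q => F q + G q) p v = fderiv ℝ F p v + fderiv ℝ G p v := by
  rw [fderiv_fun_add hF hG]
  simp

theorem fderiv_fun_sub_apply (hF : DifferentiableAt ℝ F p) (hG : DifferentiableAt ℝ G p)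
    (v : Total) :
    fderiv ℝ (fun q => F q - G q) p v = fderiv ℝ F p v - fderiv ℝ G p v := by
  rw [fderiv_fun_sub hF hG]
  simp

theorem fderiv_snd_apply (p v : Total) : fderiv ℝ (fun q : Total => q.2) p v = v.2 := by
  rw [fderiv.snd differentiableAt_id]
  simp

theorem fderiv_fderiv_eq_zero (hS : IsOpen S) (hF : ContDiffOn ℝ ∞ F S) {v : Total}
    (h : ∀ q ∈ S, fderiv ℝ F q v = 0) (w : Total) :
    ∀ r ∈ S, fderiv ℝ (fun q => fderiv ℝ F q w) r v = 0 := by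
  intro p hp
  rw [fderiv_fderiv_comm (hF.contDiffAt (hS.mem_nhds hp)),
    fderiv_apply_eq_of_eqOn hS (G := fun _ => 0) h hp]
  simp

theorem contDiffOn_fderiv_apply (hS : IsOpen S) (hF : ContDiffOn ℝ ∞ F S) (v : Total) :
    ContDiffOn ℝ ∞ (fun q => fderiv ℝ F q v) S := fun _ hp =>
  ((hF.contDiffAt (hS.mem_nhds hp)).fderiv_apply_const v).contDiffWithinAt

theorem exists_eq_const (hS : IsOpen S) (hc : IsConnected S) (hF : ContDiffOn ℝ ∞ F S)
    (h : ∀ q ∈ S, dT F q = 0 ∧ dX F q = 0 ∧ dY F q = 0 ∧ dU F q = 0) :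
    ∃ c, ∀ q ∈ S, F q = c := by
  refine hS.exists_is_const_of_fderiv_eq_zero hc.isPreconnected
    (hF.differentiableOn (by simp)) fun q hq => ?_
  refine ContinuousLinearMap.ext fun v => ?_
  obtain ⟨h1, h2, h3, h4⟩ := h q hq
  rw [fderiv_total_apply, h1, h2, h3, h4]
  simp

end Differentiation

/-- The solution of the determining equations. -/
theorem exists_affine_of_jetCondition {T X Y U : Total → ℝ} {S : Set Total} (hS : IsOpen S)
    (hc : IsConnected S) (sT : ContDiffOn ℝ ∞ T S) (sX : ContDiffOn ℝ ∞ X S)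
    (sY : ContDiffOn ℝ ∞ Y S) (sU : ContDiffOn ℝ ∞ U S)
    (Ty : ∀ p ∈ S, dY T p = 0) (Tu : ∀ p ∈ S, dU T p = 0)
    (Xy : ∀ p ∈ S, dY X p = 0) (Xu : ∀ p ∈ S, dU X p = 0)
    (hΔ : ∀ p ∈ S, dT T p * dX X p - dX T p * dT X p ≠ 0)
    (hj : ∀ p ∈ S, dY Y p * dU U p - dU Y p * dY U p ≠ 0)
    (hJ : ∀ p ∈ S, JetCondition T X Y U p) :
    ∃ δ₁ δ₂ δ₃ δ₄ δ₅ δ₆ : ℝ, δ₁ * δ₂ ≠ 0 ∧ ∀ p ∈ S, T p = δ₁ ^ 2 * p.1.1 + δ₃ ∧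
      X p = δ₂ * p.1.2.1 + δ₄ * p.1.1 + δ₆ ∧ Y p = δ₁ * p.1.2.2 + δ₅ ∧
      U p = (δ₁ ^ 2)⁻¹ * (δ₂ * p.2 + δ₄) := by
  have s1 {F : Total → ℝ} (hF : ContDiffOn ℝ ∞ F S) : ContDiffOn ℝ ∞ (dT F) S ∧
      ContDiffOn ℝ ∞ (dX F) S ∧ ContDiffOn ℝ ∞ (dY F) S ∧ ContDiffOn ℝ ∞ (dU F) S :=
    ⟨contDiffOn_fderiv_apply hS hF _, contDiffOn_fderiv_apply hS hF _,
      contDiffOn_fderiv_apply hS hF _, contDiffOn_fderiv_apply hS hF _⟩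
  have dif {F : Total → ℝ} (hF : ContDiffOn ℝ ∞ F S) {p : Total} (hp : p ∈ S) :
      DifferentiableAt ℝ F p := (hF.contDiffAt (hS.mem_nhds hp)).differentiableAt (by simp)
  have comm {F : Total → ℝ} (hF : ContDiffOn ℝ ∞ F S) {p : Total} (hp : p ∈ S) (v w : Total) :=
    fderiv_fderiv_comm (hF.contDiffAt (hS.mem_nhds hp)) v w
  have z {F : Total → ℝ} (h : ∀ q ∈ S, F q = 0) {p : Total} (hp : p ∈ S) (v : Total) :
      fderiv ℝ F p v = 0 := by
    rw [fderiv_apply_eq_of_eqOn hS (G := fun _ => 0) h hp]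
    simp
  obtain ⟨sTt, sTx, -, -⟩ := s1 sT
  obtain ⟨sXt, sXx, -, -⟩ := s1 sX
  obtain ⟨-, -, sYy, -⟩ := s1 sY
  obtain ⟨-, -, -, sUu⟩ := s1 sU
  obtain ⟨sXtt, -, -, -⟩ := s1 sXt
  obtain ⟨sXxt, sXxx, -, -⟩ := s1 sXx
  have Yu : ∀ p ∈ S, dU Y p = 0 := fun p hp => ((hJ p hp).first_order (hΔ p hp) (hj p hp)).1
  have Yy0 : ∀ p ∈ S, dY Y p ≠ 0 := by
    intro p hp h0
    apply hj p hp
    rw [h0, Yu p hp]; ring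
  have Uu0 : ∀ p ∈ S, dU U p ≠ 0 := by
    intro p hp h0
    apply hj p hp
    rw [h0, Yu p hp]; ring
  have Ttu : ∀ p ∈ S, dU (dT T) p = 0 := fderiv_fderiv_eq_zero hS sT Tu _
  have Txu : ∀ p ∈ S, dU (dX T) p = 0 := fderiv_fderiv_eq_zero hS sT Tu _
  have Tty : ∀ p ∈ S, dY (dT T) p = 0 := fderiv_fderiv_eq_zero hS sT Ty _
  have Xtu : ∀ p ∈ S, dU (dT X) p = 0 := fderiv_fderiv_eq_zero hS sX Xu _
  have Xxu : ∀ p ∈ S, dU (dX X) p = 0 := fderiv_fderiv_eq_zero hS sX Xu _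
  have Xty : ∀ p ∈ S, dY (dT X) p = 0 := fderiv_fderiv_eq_zero hS sX Xy _
  have Xxy : ∀ p ∈ S, dY (dX X) p = 0 := fderiv_fderiv_eq_zero hS sX Xy _
  have Yyu : ∀ p ∈ S, dU (dY Y) p = 0 := fderiv_fderiv_eq_zero hS sY Yu _
  have Ytu : ∀ p ∈ S, dU (dT Y) p = 0 := fderiv_fderiv_eq_zero hS sY Yu _
  have Yxu : ∀ p ∈ S, dU (dX Y) p = 0 := fderiv_fderiv_eq_zero hS sY Yu _
  -- In the relation from `first_order` only `U` depends on `u`, so its `u`-derivative isolates `U_u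
  -- Y_y ^ 2 T_x`.
  have Tx : ∀ p ∈ S, dX T p = 0 := by
    intro p hp
    have h1 := fderiv_apply_eq_of_eqOn hS
      (F := fun q => (dX X q - U q * dX T q) * (dY Y q * dY Y q))
      (G := fun q => dT T q * dX X q - dX T q * dT X q)
      (fun q hq => by
        rw [← ((hJ q hq).first_order (hΔ q hq) (hj q hq)).2.1]; ring) hp ((0, 0, 0), 1)
    have d1 := dif sXx hp
    have d2 := dif sU hp
    have d3 := dif sTx hp
    have d4 := dif sYy hp
    have d5 := dif sTt hp
    have d6 := dif sXt hp
    rw [fderiv_fun_mul_apply (d1.fun_sub (d2.fun_mul d3)) (d4.fun_mul d4), fderiv_fun_mul_apply d4 d4,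
      fderiv_fun_sub_apply d1 (d2.fun_mul d3), fderiv_fun_mul_apply d2 d3,
      fderiv_fun_sub_apply (d5.fun_mul d1) (d3.fun_mul d6), fderiv_fun_mul_apply d5 d1,
      fderiv_fun_mul_apply d3 d6] at h1
    simp only [fderiv_eq_dU] at h1
    rw [Xxu p hp, Txu p hp, Yyu p hp, Ttu p hp, Xtu p hp] at h1
    have h2 : dU U p * dY Y p ^ 2 * dX T p = 0 := by linear_combination - h1
    exact (mul_eq_zero.1 h2).resolve_left (mul_ne_zero (Uu0 p hp) (pow_ne_zero 2 (Yy0 p hp)))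
  have Xx0 : ∀ p ∈ S, dX X p ≠ 0 := by
    intro p hp h0
    apply hΔ p hp
    rw [h0, Tx p hp]; ring
  have Tt : ∀ p ∈ S, dY Y p * dY Y p = dT T p := by
    intro p hp
    have h1 := ((hJ p hp).first_order (hΔ p hp) (hj p hp)).2.1
    rw [Tx p hp] at h1
    refine mul_right_cancel₀ (Xx0 p hp) ?_
    linear_combination h1
  have Tt0 : ∀ p ∈ S, dT T p ≠ 0 := fun p hp => by
    rw [← Tt p hp]
    exact mul_ne_zero (Yy0 p hp) (Yy0 p hp)
  have hU : ∀ p ∈ S, U p * dT T p = p.2 * dX X p + dT X p := by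
    intro p hp
    have h1 := ((hJ p hp).first_order (hΔ p hp) (hj p hp)).2.2
    rw [Tx p hp, pow_two, Tt p hp] at h1
    refine mul_right_cancel₀ (Tt0 p hp) ?_
    linear_combination h1
  have hU' : ∀ p ∈ S, ∀ v : Total, fderiv ℝ U p v * dT T p + U p * fderiv ℝ (dT T) p v =
      v.2 * dX X p + p.2 * fderiv ℝ (dX X) p v + fderiv ℝ (dT X) p v := by
    intro p hp v
    have h1 := fderiv_apply_eq_of_eqOn hS hU hp v
    have d0 : DifferentiableAt ℝ (fun q : Total => q.2) p := differentiableAt_snd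
    rwa [fderiv_fun_mul_apply (dif sU hp) (dif sTt hp),
      fderiv_fun_add_apply (d0.fun_mul (dif sXx hp)) (dif sXt hp),
      fderiv_fun_mul_apply d0 (dif sXx hp), fderiv_snd_apply] at h1
  have Uy : ∀ p ∈ S, dY U p = 0 := by
    intro p hp
    have h1 := hU' p hp ((0, 0, 1), 0)
    simp only [fderiv_eq_dY] at h1
    rw [Tty p hp, Xxy p hp, Xty p hp] at h1
    exact (mul_eq_zero.1 (by linear_combination h1)).resolve_right (Tt0 p hp)
  have Uu : ∀ p ∈ S, dU U p * dT T p = dX X p := by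
    intro p hp
    have h1 := hU' p hp ((0, 0, 0), 1)
    simp only [fderiv_eq_dU] at h1
    rw [Ttu p hp, Xxu p hp, Xtu p hp] at h1
    linear_combination h1
  have Uuu : ∀ p ∈ S, dU (dU U) p = 0 := by
    intro p hp
    have h1 := fderiv_apply_eq_of_eqOn hS Uu hp ((0, 0, 0), 1)
    rw [fderiv_fun_mul_apply (dif sUu hp) (dif sTt hp)] at h1
    simp only [fderiv_eq_dU] at h1
    rw [Ttu p hp, Xxu p hp] at h1
    exact (mul_eq_zero.1 (by linear_combination h1)).resolve_right (Tt0 p hp)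
  have Tt' : ∀ p ∈ S, ∀ v : Total, 2 * dY Y p * fderiv ℝ (dY Y) p v = fderiv ℝ (dT T) p v := by
    intro p hp v
    have h1 := fderiv_apply_eq_of_eqOn hS Tt hp v
    rw [fderiv_fun_mul_apply (dif sYy hp) (dif sYy hp)] at h1
    linear_combination h1
  have Yyy : ∀ p ∈ S, dY (dY Y) p = 0 := by
    intro p hp
    have h1 := Tt' p hp ((0, 0, 1), 0)
    simp only [fderiv_eq_dY] at h1
    rw [Tty p hp] at h1
    exact (mul_eq_zero.1 h1).resolve_left (mul_ne_zero two_ne_zero (Yy0 p hp))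
  have res : ∀ p ∈ S, dT U p + p.2 * dX U p = 0 ∧ dT Y p + p.2 * dX Y p = 0 := fun p hp =>
    (hJ p hp).residual (Tx p hp) (Yu p hp) (Yy0 p hp) (Uy p hp) (Uu0 p hp) (hU p hp)
      (z Uy hp _) (z Uy hp _) (fderiv_fderiv_eq_zero hS sU Uy _ p hp) (Uuu p hp)
      (Yyy p hp) (Yyu p hp) (z Yu hp _) (z Yu hp _)
  have Yx : ∀ p ∈ S, dX Y p = 0 := by
    intro p hp
    have h1 := z (F := fun q => dT Y q + q.2 * dX Y q) (fun q hq => (res q hq).2) hp ((0, 0, 0), 1)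
    have d0 : DifferentiableAt ℝ (fun q : Total => q.2) p := differentiableAt_snd
    have d1 := dif (s1 sY).1 hp
    have d2 := dif (s1 sY).2.1 hp
    rw [fderiv_fun_add_apply d1 (d0.fun_mul d2), fderiv_fun_mul_apply d0 d2, fderiv_snd_apply] at h1
    simp only [fderiv_eq_dU] at h1
    rw [Ytu p hp, Yxu p hp] at h1
    linear_combination h1
  have Yt : ∀ p ∈ S, dT Y p = 0 := by
    intro p hp
    have := (res p hp).2
    rw [Yx p hp] at this
    linear_combination this
  have Yyt : ∀ p ∈ S, dT (dY Y) p = 0 := fderiv_fderiv_eq_zero hS sY Yt _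
  have Yyx : ∀ p ∈ S, dX (dY Y) p = 0 := fderiv_fderiv_eq_zero hS sY Yx _
  have Ttt : ∀ p ∈ S, dT (dT T) p = 0 := by
    intro p hp
    have h1 := Tt' p hp ((1, 0, 0), 0)
    simp only [fderiv_eq_dT] at h1
    rw [← h1, Yyt p hp, mul_zero]
  have Ttx : ∀ p ∈ S, dX (dT T) p = 0 := fderiv_fderiv_eq_zero hS sT Tx _
  have Xtx : ∀ p ∈ S, dX (dT X) p = dT (dX X) p := fun p hp => comm sX hp _ _
  -- Substituting `U T_t = u X_x + X_t` into `U_t + u U_x = 0` gives a quadratic in `u` with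
  -- coefficients free of `u`; differentiating in `u` twice makes every coefficient vanish.
  have quad : ∀ p ∈ S, dT (dT X) p + p.2 * (2 * dT (dX X) p + p.2 * dX (dX X) p) = 0 := by
    intro p hp
    have h1 := hU' p hp ((1, 0, 0), 0)
    have h2 := hU' p hp ((0, 1, 0), 0)
    simp only [fderiv_eq_dT] at h1
    simp only [fderiv_eq_dX] at h2
    rw [Ttt p hp] at h1
    rw [Ttx p hp, Xtx p hp] at h2
    linear_combination - h1 - p.2 * h2 + dT T p * (res p hp).1
  have Xttu : ∀ p ∈ S, dU (dT (dT X)) p = 0 := fderiv_fderiv_eq_zero hS sXt Xtu _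
  have Xxtu : ∀ p ∈ S, dU (dT (dX X)) p = 0 := fderiv_fderiv_eq_zero hS sXx Xxu _
  have Xxxu : ∀ p ∈ S, dU (dX (dX X)) p = 0 := fderiv_fderiv_eq_zero hS sXx Xxu _
  have lin : ∀ p ∈ S, dT (dX X) p + p.2 * dX (dX X) p = 0 := by
    intro p hp
    have h1 := z (F := fun q => dT (dT X) q + q.2 * (dT (dX X) q + (dT (dX X) q +
      q.2 * dX (dX X) q))) (fun q hq => by rw [← quad q hq]; ring) hp ((0, 0, 0), 1)
    have d0 : DifferentiableAt ℝ (fun q : Total => q.2) p := differentiableAt_snd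
    have d1 := dif sXtt hp
    have d2 := dif sXxt hp
    have d3 := dif sXxx hp
    rw [fderiv_fun_add_apply d1 (d0.fun_mul (d2.fun_add (d2.fun_add (d0.fun_mul d3)))),
      fderiv_fun_mul_apply d0 (d2.fun_add (d2.fun_add (d0.fun_mul d3))),
      fderiv_fun_add_apply d2 (d2.fun_add (d0.fun_mul d3)), fderiv_fun_add_apply d2 (d0.fun_mul d3),
      fderiv_fun_mul_apply d0 d3, fderiv_snd_apply] at h1
    simp only [fderiv_eq_dU] at h1
    rw [Xttu p hp, Xxtu p hp, Xxxu p hp] at h1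
    linear_combination h1 / 2
  have Xxx : ∀ p ∈ S, dX (dX X) p = 0 := by
    intro p hp
    have h1 := z (F := fun q => dT (dX X) q + q.2 * dX (dX X) q) lin hp ((0, 0, 0), 1)
    have d0 : DifferentiableAt ℝ (fun q : Total => q.2) p := differentiableAt_snd
    rw [fderiv_fun_add_apply (dif sXxt hp) (d0.fun_mul (dif sXxx hp)),
      fderiv_fun_mul_apply d0 (dif sXxx hp), fderiv_snd_apply] at h1
    simp only [fderiv_eq_dU] at h1
    rw [Xxtu p hp, Xxxu p hp] at h1
    linear_combination h1
  have Xxt : ∀ p ∈ S, dT (dX X) p = 0 := by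
    intro p hp
    have := lin p hp
    rw [Xxx p hp] at this
    linear_combination this
  have Xtt : ∀ p ∈ S, dT (dT X) p = 0 := by
    intro p hp
    have := quad p hp
    rw [Xxx p hp, Xxt p hp] at this
    linear_combination this
  obtain ⟨δ₁, h₁⟩ := exists_eq_const hS hc sYy fun q hq => ⟨Yyt q hq, Yyx q hq, Yyy q hq, Yyu q hq⟩
  obtain ⟨δ₂, h₂⟩ := exists_eq_const hS hc sXx fun q hq => ⟨Xxt q hq, Xxx q hq, Xxy q hq, Xxu q hq⟩
  obtain ⟨δ₄, h₄⟩ := exists_eq_const hS hc sXt fun q hq =>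
    ⟨Xtt q hq, (Xtx q hq).trans (Xxt q hq), Xty q hq, Xtu q hq⟩
  have hsub {F : Total → ℝ} (hF : ContDiffOn ℝ ∞ F S) (A : Total →L[ℝ] ℝ)
      (h : ∀ q ∈ S, dT F q = A ((1, 0, 0), 0) ∧ dX F q = A ((0, 1, 0), 0) ∧
        dY F q = A ((0, 0, 1), 0) ∧ dU F q = A ((0, 0, 0), 1)) : ∃ c, ∀ q ∈ S, F q = A q + c := by
    have hv (q : Total) (hq : q ∈ S) (v : Total) :
        fderiv ℝ (fun q => F q - A q) q v = fderiv ℝ F q v - A v := by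
      rw [fderiv_fun_sub_apply (dif hF hq) A.differentiableAt, A.fderiv]
    obtain ⟨c, hc⟩ := exists_eq_const hS hc (hF.sub A.contDiff.contDiffOn) fun q hq =>
      ⟨(hv q hq _).trans (sub_eq_zero.2 (h q hq).1), (hv q hq _).trans (sub_eq_zero.2 (h q hq).2.1),
        (hv q hq _).trans (sub_eq_zero.2 (h q hq).2.2.1),
        (hv q hq _).trans (sub_eq_zero.2 (h q hq).2.2.2)⟩
    exact ⟨c, fun q hq => by linear_combination hc q hq⟩
  let At : Total →L[ℝ] ℝ := (ContinuousLinearMap.fst ℝ ℝ (ℝ × ℝ)).comp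
    (ContinuousLinearMap.fst ℝ Base ℝ)
  let Ax : Total →L[ℝ] ℝ := ((ContinuousLinearMap.fst ℝ ℝ ℝ).comp
    (ContinuousLinearMap.snd ℝ ℝ (ℝ × ℝ))).comp (ContinuousLinearMap.fst ℝ Base ℝ)
  let Ay : Total →L[ℝ] ℝ := ((ContinuousLinearMap.snd ℝ ℝ ℝ).comp
    (ContinuousLinearMap.snd ℝ ℝ (ℝ × ℝ))).comp (ContinuousLinearMap.fst ℝ Base ℝ)
  obtain ⟨δ₃, h₃⟩ := hsub sT (δ₁ ^ 2 • At) fun q hq => by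
    rw [← Tt q hq, h₁ q hq, Tx q hq, Ty q hq, Tu q hq]
    simp [At, pow_two]
  obtain ⟨δ₆, h₆⟩ := hsub sX (δ₂ • Ax + δ₄ • At) fun q hq => by
    rw [h₂ q hq, h₄ q hq, Xy q hq, Xu q hq]
    simp [At, Ax]
  obtain ⟨δ₅, h₅⟩ := hsub sY (δ₁ • Ay) fun q hq => by
    rw [h₁ q hq, Yt q hq, Yx q hq, Yu q hq]
    simp [Ay]
  obtain ⟨p₀, hp₀⟩ := hc.nonempty
  have n1 : δ₁ ≠ 0 := h₁ p₀ hp₀ ▸ Yy0 p₀ hp₀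
  have n2 : δ₂ ≠ 0 := h₂ p₀ hp₀ ▸ Xx0 p₀ hp₀
  refine ⟨δ₁, δ₂, δ₃, δ₄, δ₅, δ₆, mul_ne_zero n1 n2, fun p hp => ⟨h₃ p hp, h₆ p hp, h₅ p hp, ?_⟩⟩
  have h := hU p hp
  rw [← Tt p hp, h₁ p hp, h₂ p hp, h₄ p hp] at h
  field_simp
  linear_combination h

theorem IsPointSymmetry.exists_transformation {e : OpenPartialHomeomorph Total Total}
    (he : IsPointSymmetry e) : ∃ δ₁ δ₂ δ₃ δ₄ δ₅ δ₆ : ℝ, δ₁ * δ₂ ≠ 0 ∧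
      Set.EqOn e (transformation δ₁ δ₂ δ₃ δ₄ δ₅ δ₆) e.source := by
  have hs := he.1.2.1
  obtain ⟨δ₁, δ₂, δ₃, δ₄, δ₅, δ₆, h0, h⟩ := exists_affine_of_jetCondition e.open_source he.1.1
    hs.fst.fst hs.fst.snd.fst hs.fst.snd.snd hs.snd
    (fun p hp => (he.vertical_eq_zero hp).1) (fun p hp => (he.vertical_eq_zero hp).2.1)
    (fun p hp => (he.vertical_eq_zero hp).2.2.1) (fun p hp => (he.vertical_eq_zero hp).2.2.2)
    (fun p hp => (he.det_ne_zero hp).1) (fun p hp => (he.det_ne_zero hp).2)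
    (fun p hp => he.jetCondition hp)
  refine ⟨δ₁, δ₂, δ₃, δ₄, δ₅, δ₆, h0, fun p hp => ?_⟩
  obtain ⟨h1, h2, h3, h4⟩ := h p hp
  exact Prod.ext (Prod.ext h1 (Prod.ext h2 h3)) h4

/-! ### The listed transformations, their composition and inverses. -/

theorem contDiff_transformation (δ₁ δ₂ δ₃ δ₄ δ₅ δ₆ : ℝ) :
    ContDiff ℝ ∞ (transformation δ₁ δ₂ δ₃ δ₄ δ₅ δ₆) := by
  have : transformation δ₁ δ₂ δ₃ δ₄ δ₅ δ₆ = fun p => ((δ₁ ^ 2 * p.1.1 + δ₃,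
      δ₂ * p.1.2.1 + δ₄ * p.1.1 + δ₆, δ₁ * p.1.2.2 + δ₅), (δ₁ ^ 2)⁻¹ * (δ₂ * p.2 + δ₄)) := rfl
  rw [this]
  fun_prop

theorem transformation_comp {δ₁ δ₂ δ₃ δ₄ δ₅ δ₆ ε₁ ε₂ ε₃ ε₄ ε₅ ε₆ : ℝ} (h : δ₁ ≠ 0) (p : Total) :
    transformation ε₁ ε₂ ε₃ ε₄ ε₅ ε₆ (transformation δ₁ δ₂ δ₃ δ₄ δ₅ δ₆ p) =
      transformation (ε₁ * δ₁) (ε₂ * δ₂) (ε₁ ^ 2 * δ₃ + ε₃) (ε₂ * δ₄ + ε₄ * δ₁ ^ 2)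
        (ε₁ * δ₅ + ε₅) (ε₂ * δ₆ + ε₄ * δ₃ + ε₆) p := by
  obtain ⟨⟨t, x, y⟩, u⟩ := p
  simp only [transformation]
  refine Prod.ext (Prod.ext ?_ (Prod.ext ?_ ?_)) ?_
  · ring
  · ring
  · ring
  · dsimp only
    rw [mul_pow, mul_inv]
    field_simp
    ring

theorem transformation_one (p : Total) : transformation 1 1 0 0 0 0 p = p := by
  obtain ⟨⟨t, x, y⟩, u⟩ := p
  simp [transformation]

/-- The inverse of a transformation. -/
noncomputable def inverseTransformation (δ₁ δ₂ δ₃ δ₄ δ₅ δ₆ : ℝ) : Total → Total :=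
  transformation δ₁⁻¹ δ₂⁻¹ (-(δ₃ / δ₁ ^ 2)) (-(δ₄ / (δ₂ * δ₁ ^ 2))) (-(δ₅ / δ₁))
    ((δ₄ * δ₃ / δ₁ ^ 2 - δ₆) / δ₂)

section Inverse

variable {δ₁ δ₂ δ₃ δ₄ δ₅ δ₆ : ℝ}

theorem inverseTransformation_transformation (h₁ : δ₁ ≠ 0) (h₂ : δ₂ ≠ 0) (p : Total) :
    inverseTransformation δ₁ δ₂ δ₃ δ₄ δ₅ δ₆ (transformation δ₁ δ₂ δ₃ δ₄ δ₅ δ₆ p) = p := by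
  rw [inverseTransformation, transformation_comp h₁]
  conv_rhs => rw [← transformation_one p]
  congr 1 <;> field_simp <;> ring

theorem transformation_inverseTransformation (h₁ : δ₁ ≠ 0) (h₂ : δ₂ ≠ 0) (p : Total) :
    transformation δ₁ δ₂ δ₃ δ₄ δ₅ δ₆ (inverseTransformation δ₁ δ₂ δ₃ δ₄ δ₅ δ₆ p) = p := by
  rw [inverseTransformation, transformation_comp (inv_ne_zero h₁)]
  conv_rhs => rw [← transformation_one p]
  congr 1 <;> field_simp <;> ring

/-- A transformation as a homeomorphism of the whole space. -/
noncomputable def transformationHomeomorph (δ₃ δ₄ δ₅ δ₆ : ℝ) (h₁ : δ₁ ≠ 0) (h₂ : δ₂ ≠ 0) :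
    Total ≃ₜ Total where
  toFun := transformation δ₁ δ₂ δ₃ δ₄ δ₅ δ₆
  invFun := inverseTransformation δ₁ δ₂ δ₃ δ₄ δ₅ δ₆
  left_inv := inverseTransformation_transformation h₁ h₂
  right_inv := transformation_inverseTransformation h₁ h₂
  continuous_toFun := (contDiff_transformation _ _ _ _ _ _).continuous
  continuous_invFun := (contDiff_transformation _ _ _ _ _ _).continuous

end Inverse

/-! ### The listed transformations preserve solutions. -/

/-- The action of a transformation on the independent variables. -/
def baseMap (ε₁ ε₂ ε₃ ε₄ ε₅ ε₆ : ℝ) (P : Base) : Base :=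
  (ε₁ ^ 2 * P.1 + ε₃, ε₂ * P.2.1 + ε₄ * P.1 + ε₆, ε₁ * P.2.2 + ε₅)

section BaseMap

variable (ε₁ ε₂ ε₃ ε₄ ε₅ ε₆ : ℝ)

theorem contDiff_baseMap : ContDiff ℝ ∞ (baseMap ε₁ ε₂ ε₃ ε₄ ε₅ ε₆) := by
  unfold baseMap
  fun_prop

theorem fderiv_baseMap (P v : Base) : fderiv ℝ (baseMap ε₁ ε₂ ε₃ ε₄ ε₅ ε₆) P v =
    (ε₁ ^ 2 * v.1, ε₂ * v.2.1 + ε₄ * v.1, ε₁ * v.2.2) := by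
  have ht : HasFDerivAt (fun p : Base => p.1) _ P := hasFDerivAt_fst (𝕜 := ℝ)
  have hx : HasFDerivAt (fun p : Base => p.2.1) _ P := (hasFDerivAt_snd (𝕜 := ℝ)).fst
  have hy : HasFDerivAt (fun p : Base => p.2.2) _ P := (hasFDerivAt_snd (𝕜 := ℝ)).snd
  have h := ((ht.const_mul (ε₁ ^ 2)).add_const ε₃).prodMk
    ((((hx.const_mul ε₂).add (ht.const_mul ε₄)).add_const ε₆).prodMk
      ((hy.const_mul ε₁).add_const ε₅))
  refine (congrArg (fun A : Base →L[ℝ] Base => A v) (HasFDerivAt.fderiv h)).trans ?_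
  simp

theorem secondDeriv_baseMap (P w : Base) : secondDeriv (baseMap ε₁ ε₂ ε₃ ε₄ ε₅ ε₆) P w = 0 := by
  simp [secondDeriv, fderiv_baseMap]

variable {ε₁ ε₂ ε₃ ε₄ ε₅ ε₆}

/-- The chain rule adds `ε₄ f_x` to the derivative in `t`, which the shift by `-ε₄` cancels in the
convective term; what remains is the original equation at the image point times `ε₂⁻¹ ε₁ ^ 4`. -/
theorem IsSolutionOn.transform {f : Base → ℝ} {Ω : Set Base} (hf : IsSolutionOn f Ω)
    (hΩ : IsOpen Ω) (h₂ : ε₂ ≠ 0) :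
    IsSolutionOn (fun P => ε₂⁻¹ * (ε₁ ^ 2 * f (baseMap ε₁ ε₂ ε₃ ε₄ ε₅ ε₆ P) - ε₄))
      (baseMap ε₁ ε₂ ε₃ ε₄ ε₅ ε₆ ⁻¹' Ω) := by
  set β := baseMap ε₁ ε₂ ε₃ ε₄ ε₅ ε₆ with hβ
  have sβ : ContDiff ℝ ∞ β := contDiff_baseMap _ _ _ _ _ _
  have s : ContDiffOn ℝ ∞ (f ∘ β) (β ⁻¹' Ω) := hf.1.comp sβ.contDiffOn fun _ h => h
  have hh : (fun P => ε₂⁻¹ * (ε₁ ^ 2 * f (β P) - ε₄)) =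
      fun P => ε₂⁻¹ * ε₁ ^ 2 * (f ∘ β) P - ε₂⁻¹ * ε₄ := by
    funext P
    simp only [Function.comp]
    ring
  rw [hh]
  refine ⟨(contDiffOn_const.mul s).sub contDiffOn_const, fun P hP => ?_⟩
  have hfP : ContDiffAt ℝ ∞ f (β P) := hf.1.contDiffAt (hΩ.mem_nhds hP)
  have hcP : ContDiffAt ℝ ∞ (f ∘ β) P := hfP.comp P sβ.contDiffAt
  have hd (Q : Base) (hQ : DifferentiableAt ℝ (f ∘ β) Q) (v : Base) :
      fderiv ℝ (fun P => ε₂⁻¹ * ε₁ ^ 2 * (f ∘ β) P - ε₂⁻¹ * ε₄) Q v =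
        ε₂⁻¹ * ε₁ ^ 2 * fderiv ℝ (f ∘ β) Q v := by
    rw [fderiv_sub_const, fderiv_const_mul hQ]
    simp
  have hd1 (v : Base) : fderiv ℝ (f ∘ β) P v =
      ε₁ ^ 2 * v.1 * fderiv ℝ f (β P) (1, 0, 0) +
        (ε₂ * v.2.1 + ε₄ * v.1) * fderiv ℝ f (β P) (0, 1, 0) +
        ε₁ * v.2.2 * fderiv ℝ f (β P) (0, 0, 1) := by
    rw [← clm_base_apply (fderiv ℝ f (β P)) (ε₁ ^ 2 * v.1, ε₂ * v.2.1 + ε₄ * v.1, ε₁ * v.2.2),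
      fderiv_comp P (hfP.differentiableAt (by simp)) (sβ.contDiffAt.differentiableAt (by simp)),
      ← fderiv_baseMap ε₁ ε₂ ε₃ ε₄ ε₅ ε₆ P v]
    rfl
  have hs : secondDeriv (f ∘ β) P (0, 0, 1) = ε₁ ^ 2 * partialY (partialY f) (β P) := by
    have hlin : (fun q => fderiv ℝ f q (0, 0, ε₁)) = fun q => ε₁ * fderiv ℝ f q (0, 0, 1) := by
      funext q
      rw [← smul_eq_mul, ← map_smul]
      simp
    have hdy : DifferentiableAt ℝ (fun q => fderiv ℝ f q (0, 0, 1)) (β P) :=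
      (hfP.fderiv_apply_const _).differentiableAt (by simp)
    rw [secondDeriv_comp hfP sβ.contDiffAt, secondDeriv_baseMap, fderiv_baseMap, map_zero, add_zero]
    simp only [mul_zero, add_zero, mul_one]
    rw [secondDeriv, hlin, fderiv_const_mul hdy,
      show ((0 : ℝ), (0 : ℝ), ε₁) = ε₁ • ((0 : ℝ), (0 : ℝ), (1 : ℝ)) by simp, map_smul]
    simp only [smul_apply, smul_eq_mul]
    change _ = ε₁ ^ 2 * fderiv ℝ (fun q => fderiv ℝ f q (0, 0, 1)) (β P) (0, 0, 1)
    ring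
  have hs2 : partialY (partialY fun P => ε₂⁻¹ * ε₁ ^ 2 * (f ∘ β) P - ε₂⁻¹ * ε₄) P =
      ε₂⁻¹ * ε₁ ^ 2 * secondDeriv (f ∘ β) P (0, 0, 1) := by
    have hev : (partialY fun P => ε₂⁻¹ * ε₁ ^ 2 * (f ∘ β) P - ε₂⁻¹ * ε₄) =ᶠ[nhds P]
        fun Q => ε₂⁻¹ * ε₁ ^ 2 * fderiv ℝ (f ∘ β) Q (0, 0, 1) := by
      filter_upwards [eventually_differentiableAt hcP] with Q hQ
      exact hd Q hQ _
    rw [partialY, hev.fderiv_eq,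
      fderiv_const_mul ((hcP.fderiv_apply_const _).differentiableAt (by simp))]
    rfl
  have hsol := hf.2 (β P) hP
  rw [hs2, hs, partialT, partialX, hd P (hcP.differentiableAt (by simp)),
    hd P (hcP.differentiableAt (by simp)), hd1, hd1]
  rw [partialT, partialX] at hsol
  simp only [Function.comp, mul_one, mul_zero, zero_mul, add_zero, zero_add]
  field_simp
  linear_combination ε₁ ^ 4 * hsol

end BaseMap

theorem IsSolutionOn.mono {f : Base → ℝ} {Ω Ω' : Set Base} (hf : IsSolutionOn f Ω) (h : Ω' ⊆ Ω) :
    IsSolutionOn f Ω' :=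
  ⟨hf.1.mono h, fun P hP => hf.2 P (h hP)⟩

theorem IsSolutionOn.congr {f g : Base → ℝ} {Ω : Set Base} (hf : IsSolutionOn f Ω) (hΩ : IsOpen Ω)
    (h : ∀ P ∈ Ω, g P = f P) : IsSolutionOn g Ω := by
  refine ⟨hf.1.congr h, fun P hP => ?_⟩
  have h1 : ∀ Q ∈ Ω, g =ᶠ[nhds Q] f := fun Q hQ => Filter.mem_of_superset (hΩ.mem_nhds hQ) h
  have h2 : partialY g =ᶠ[nhds P] partialY f := by
    filter_upwards [hΩ.mem_nhds hP] with Q hQ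
    rw [partialY, (h1 Q hQ).fderiv_eq, partialY]
  have := hf.2 P hP
  rw [partialT, partialX, partialY] at this ⊢
  rw [h2.fderiv_eq, (h1 P hP).fderiv_eq, h P hP]
  exact this

theorem isPointSymmetry_of_eqOn {e : OpenPartialHomeomorph Total Total} (hc : IsConnected e.source)
    {δ₁ δ₂ δ₃ δ₄ δ₅ δ₆ : ℝ} (h₁ : δ₁ ≠ 0) (h₂ : δ₂ ≠ 0)
    (h : Set.EqOn e (transformation δ₁ δ₂ δ₃ δ₄ δ₅ δ₆) e.source) : IsPointSymmetry e := by
  have hsymm : Set.EqOn e.symm (inverseTransformation δ₁ δ₂ δ₃ δ₄ δ₅ δ₆) e.target := by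
    intro Z hZ
    conv_rhs => rw [← e.right_inv hZ, h (e.map_target hZ)]
    rw [inverseTransformation_transformation h₁ h₂]
  refine ⟨⟨hc, (contDiff_transformation _ _ _ _ _ _).contDiffOn.congr h,
    (contDiff_transformation _ _ _ _ _ _).contDiffOn.congr hsymm⟩, ?_⟩
  intro Ω Ω' f g hΩ hΩ' hf hsub hg him
  -- The new solution is the old one pulled back along the base part of the inverse transformation,
  -- so the parameters are those of `inverseTransformation`.
  set β := baseMap δ₁⁻¹ δ₂⁻¹ (-(δ₃ / δ₁ ^ 2)) (-(δ₄ / (δ₂ * δ₁ ^ 2))) (-(δ₅ / δ₁))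
    ((δ₄ * δ₃ / δ₁ ^ 2 - δ₆) / δ₂) with hβ
  have key : ∀ P ∈ Ω', β P ∈ Ω ∧ g P = (δ₂⁻¹)⁻¹ * (δ₁⁻¹ ^ 2 * f (β P) - -(δ₄ / (δ₂ * δ₁ ^ 2))) := by
    intro P hP
    have hmem : (P, g P) ∈ e '' Ω.graphOn f := by
      rw [him]; exact ⟨P, hP, rfl⟩
    obtain ⟨_, ⟨q, hq, rfl⟩, hqP⟩ := hmem
    rw [h (hsub ⟨q, hq, rfl⟩)] at hqP
    have h3 : (q, f q) = inverseTransformation δ₁ δ₂ δ₃ δ₄ δ₅ δ₆ (P, g P) := by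
      rw [← hqP, inverseTransformation_transformation h₁ h₂]
    have hqβ : q = β P := congrArg Prod.fst h3
    have h4 : (δ₁ ^ 2)⁻¹ * (δ₂ * f q + δ₄) = g P := congrArg Prod.snd hqP
    rw [← hqβ]
    refine ⟨hq, ?_⟩
    rw [← h4]
    field_simp
    ring
  exact ((hf.transform hΩ (inv_ne_zero h₂)).mono fun P hP => (key P hP).1).congr hΩ'
    fun P hP => (key P hP).2

end DegenerateBurgers

/-! ### The characterization and the symmetry group. -/

theorem mainTheorem1 :
    -- the point symmetries defined on arbitrary connected open domains
    (∀ e : OpenPartialHomeomorph DegenerateBurgers.Total DegenerateBurgers.Total,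
      IsConnected e.source →
      (DegenerateBurgers.IsPointSymmetry e ↔
        ∃ δ₁ δ₂ δ₃ δ₄ δ₅ δ₆ : ℝ, δ₁ * δ₂ ≠ 0 ∧
          Set.EqOn e (DegenerateBurgers.transformation δ₁ δ₂ δ₃ δ₄ δ₅ δ₆) e.source)) ∧
    -- the point symmetries defined on the whole space form a group, which consists exactly of
    -- the listed transformations
    (∃ G : Subgroup (DegenerateBurgers.Total ≃ₜ DegenerateBurgers.Total),
      (∀ h : DegenerateBurgers.Total ≃ₜ DegenerateBurgers.Total,
        h ∈ G ↔ DegenerateBurgers.IsPointSymmetry h.toOpenPartialHomeomorph) ∧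
      {F : DegenerateBurgers.Total → DegenerateBurgers.Total | ∃ h ∈ G, F = h} =
        {F | ∃ δ₁ δ₂ δ₃ δ₄ δ₅ δ₆ : ℝ, δ₁ * δ₂ ≠ 0 ∧
          F = DegenerateBurgers.transformation δ₁ δ₂ δ₃ δ₄ δ₅ δ₆}) := by
  have hchar : ∀ e : OpenPartialHomeomorph DegenerateBurgers.Total DegenerateBurgers.Total,
      IsConnected e.source →
      (DegenerateBurgers.IsPointSymmetry e ↔
        ∃ δ₁ δ₂ δ₃ δ₄ δ₅ δ₆ : ℝ, δ₁ * δ₂ ≠ 0 ∧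
          Set.EqOn e (DegenerateBurgers.transformation δ₁ δ₂ δ₃ δ₄ δ₅ δ₆) e.source) := by
    refine fun e hc => ⟨fun he => he.exists_transformation, ?_⟩
    rintro ⟨δ₁, δ₂, δ₃, δ₄, δ₅, δ₆, h0, h⟩
    exact DegenerateBurgers.isPointSymmetry_of_eqOn hc (left_ne_zero_of_mul h0)
      (right_ne_zero_of_mul h0) h
  refine ⟨hchar, ?_⟩
  have hglob (h : DegenerateBurgers.Total ≃ₜ DegenerateBurgers.Total) :
      DegenerateBurgers.IsPointSymmetry h.toOpenPartialHomeomorph ↔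
        ∃ δ₁ δ₂ δ₃ δ₄ δ₅ δ₆ : ℝ, δ₁ * δ₂ ≠ 0 ∧
          ⇑h = DegenerateBurgers.transformation δ₁ δ₂ δ₃ δ₄ δ₅ δ₆ := by
    rw [hchar h.toOpenPartialHomeomorph isConnected_univ]
    simp only [Homeomorph.toOpenPartialHomeomorph_source, Set.eqOn_univ,
      Homeomorph.toOpenPartialHomeomorph_apply]
  -- The group is defined by the explicit family, so closure is a computation with parameters;
  -- `hglob` identifies its members with the point symmetries.
  refine ⟨{ carrier := {h | ∃ δ₁ δ₂ δ₃ δ₄ δ₅ δ₆ : ℝ, δ₁ * δ₂ ≠ 0 ∧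
              ⇑h = DegenerateBurgers.transformation δ₁ δ₂ δ₃ δ₄ δ₅ δ₆}
            mul_mem' := ?_, one_mem' := ?_, inv_mem' := ?_ }, fun h => (hglob h).symm, ?_⟩
  · rintro g h ⟨ε₁, ε₂, ε₃, ε₄, ε₅, ε₆, hε, hg⟩ ⟨δ₁, δ₂, δ₃, δ₄, δ₅, δ₆, hδ, hh⟩
    refine ⟨ε₁ * δ₁, ε₂ * δ₂, _, _, _, _, ?_, Eq.trans ?_ (funext fun p =>
      DegenerateBurgers.transformation_comp (δ₂ := δ₂) (δ₃ := δ₃) (δ₄ := δ₄) (δ₅ := δ₅) (δ₆ := δ₆)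
        (ε₁ := ε₁) (ε₂ := ε₂) (ε₃ := ε₃) (ε₄ := ε₄) (ε₅ := ε₅) (ε₆ := ε₆)
        (left_ne_zero_of_mul hδ) p)⟩
    · rw [mul_mul_mul_comm]
      exact mul_ne_zero hε hδ
    · rw [← hg, ← hh]
      rfl
  · exact ⟨1, 1, 0, 0, 0, 0, by norm_num, funext fun p =>
      (DegenerateBurgers.transformation_one p).symm⟩
  · rintro h ⟨δ₁, δ₂, δ₃, δ₄, δ₅, δ₆, hδ, hh⟩
    have h₁ := left_ne_zero_of_mul hδ
    have h₂ := right_ne_zero_of_mul hδ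
    have key : ⇑h⁻¹ = DegenerateBurgers.inverseTransformation δ₁ δ₂ δ₃ δ₄ δ₅ δ₆ := funext fun p => by
      change h.symm p = _
      rw [h.symm_apply_eq, hh, DegenerateBurgers.transformation_inverseTransformation h₁ h₂]
    exact ⟨_, _, _, _, _, _, mul_ne_zero (inv_ne_zero h₁) (inv_ne_zero h₂), key⟩
  · ext F
    constructor
    · rintro ⟨h, ⟨δ₁, δ₂, δ₃, δ₄, δ₅, δ₆, hδ, hh⟩, rfl⟩
      exact ⟨δ₁, δ₂, δ₃, δ₄, δ₅, δ₆, hδ, hh⟩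
    · rintro ⟨δ₁, δ₂, δ₃, δ₄, δ₅, δ₆, hδ, rfl⟩
      exact ⟨DegenerateBurgers.transformationHomeomorph δ₃ δ₄ δ₅ δ₆ (left_ne_zero_of_mul hδ)
        (right_ne_zero_of_mul hδ), ⟨δ₁, δ₂, δ₃, δ₄, δ₅, δ₆, hδ, rfl⟩, rfl⟩
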